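/- Let $k$ be an algebraically closed field, let $m\geqslant 3$, and let $d,\ell$ be positive integers such that $d$ is even and $\frac{m-1}{\ell}=\frac d2$. Let $Q$ be the quiver $m\to\cdots\to 2\to 1$, let $\Phi=kQ/(\operatorname{rad}kQ)^{\ell}$, and let $p_i=e_i\Phi$ and $q_i=\operatorname{Hom}_k(\Phi e_i,k)$ be the indecomposable projective and injective right $\Phi$-modules at the vertex $i$. Put $f_i=p_i$ for $1\leqslant i\leqslant m$, put $f_i=q_{i-\ell+1}$ for $m+1\leqslant i\leqslant m+\ell-1$, and let $\mathscr F=\operatorname{add}\big(\bigoplus_{i=1}^{m+\ell-1}f_i\big)$, a full subcategory of the category of finitely generated right $\Phi$-modules. Let $\mathscr W\subseteq\mathscr F$ be an additive subcategory, i.e. a full subcategory closed under isomorphisms, (finite) direct sums and direct summands. Then the following are equivalent: (a) $\mathscr W$ is semisimple and wide; (b) for all $i\neq j$ in $\{1,\dots,m+\ell-1\}$ with $f_i,f_j\in\mathscr W$ one has $\ell\leqslant|i-j|\leqslant m-1$. Here $\mathscr W$ is semisimple if the endomorphism ring of each object of $\mathscr W$ is semisimple. A $d$-kernel in $\mathscr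 F$ of a morphism $x_1\to x_0$ is a diagram $x_{d+1}\to\cdots\to x_2\to x_1$ such that $0\to\mathscr F(x,x_{d+1})\to\cdots\to\mathscr F(x,x_1)\to\mathscr F(x,x_0)$ is exact for each $x\in\mathscr F$; a $d$-cokernel is defined dually; a diagram $x_{d+1}\to\cdots\to x_0$ is $d$-exact if $x_{d+1}\to\cdots\to x_1$ is a $d$-kernel of $x_1\to x_0$ and $x_d\to\cdots\to x_0$ is a $d$-cokernel of $x_{d+1}\to x_d$. The additive subcategory $\mathscr W$ is wide if each morphism in $\mathscr W$ has a $d$-kernel and a $d$-cokernel in $\mathscr F$ consisting of objects of $\mathscr W$, and each $d$-exact sequence $0\to w'\to x_d\to\cdots\to x_1\to w''\to 0$ in $\mathscr F$ with $w',w''\in\mathscr W$ is Yoneda equivalent to a $d$-exact sequence $0\to w'\to w_d\to\cdots\to w_1\to w''\to 0$ in $\mathscr F$ with all $w_i\in\mathscr W$, where Yoneda equivalence is the equivalence relation generated by the morphisms of $d$-exact sequences that are the identity on $w'$ and on $w''$. -/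

import Mathlib

open CategoryTheory

universe u v w

/-! ### Higher homological notions in a preadditive category -/

section HigherHomological

variable {M : Type u} [Category.{v} M] [Preadditive M]

/-- `W` is (the object class of) an additive subcategory: a full subcategory closed under
isomorphisms, under finite direct sums (including the empty one) and under direct summands. -/
structure IsAdditiveSubcategory (W : ObjectProperty M) : Prop where
  iso : ∀ {X Y : M}, (X ≅ Y) → W X → W Y
  zero : ∀ {Z : M}, Limits.IsZero Z → W Z
  sum : ∀ {X Y : M} (b : Limits.BinaryBicone X Y), b.IsBilimit → W X → W Y → W b.pt
  summand : ∀ {X Y : M} (b : Limits.BinaryBicone X Y), b.IsBilimit → W b.pt → W X ∧ W Y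

/-- For a diagram `S : S₀ ⟶ S₁ ⟶ ⋯ ⟶ S_d ⟶ S_{d+1}`, the part `S₀ ⟶ ⋯ ⟶ S_d` is a `d`-kernel of
the last morphism `S_d ⟶ S_{d+1}`: the sequence
`0 ⟶ Hom(T, S₀) ⟶ Hom(T, S₁) ⟶ ⋯ ⟶ Hom(T, S_{d+1})` is exact for all `T`. -/
structure IsDKernel {d : ℕ} (S : ComposableArrows M (d + 1)) : Prop where
  injective : ∀ (T : M) (f : T ⟶ S.obj' 0), f ≫ S.map' 0 1 = 0 → f = 0
  exact : ∀ (i : ℕ) (hi : i < d) (T : M) (f : T ⟶ S.obj' (i + 1)),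
    f ≫ S.map' (i + 1) (i + 2) = 0 ↔ ∃ g : T ⟶ S.obj' i, g ≫ S.map' i (i + 1) = f

/-- For a diagram `S : S₀ ⟶ S₁ ⟶ ⋯ ⟶ S_d ⟶ S_{d+1}`, the part `S₁ ⟶ ⋯ ⟶ S_{d+1}` is a
`d`-cokernel of the first morphism `S₀ ⟶ S₁`: the sequence
`0 ⟶ Hom(S_{d+1}, T) ⟶ Hom(S_d, T) ⟶ ⋯ ⟶ Hom(S₀, T)` is exact for all `T`. -/
structure IsDCokernel {d : ℕ} (S : ComposableArrows M (d + 1)) : Prop where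
  injective : ∀ (T : M) (f : S.obj' (d + 1) ⟶ T), S.map' d (d + 1) ≫ f = 0 → f = 0
  exact : ∀ (i : ℕ) (hi : i < d) (T : M) (f : S.obj' (i + 1) ⟶ T),
    S.map' i (i + 1) ≫ f = 0 ↔ ∃ g : S.obj' (i + 2) ⟶ T, S.map' (i + 1) (i + 2) ≫ g = f

/-- A `d`-exact sequence `S₀ ⟶ S₁ ⟶ ⋯ ⟶ S_{d+1}`. -/
structure IsDExact {d : ℕ} (S : ComposableArrows M (d + 1)) : Prop where
  kernel : IsDKernel S
  cokernel : IsDCokernel S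

/-- A `d`-exact sequence `0 ⟶ A ⟶ S₁ ⟶ ⋯ ⟶ S_d ⟶ B ⟶ 0` with prescribed ends `A` and `B`
(the ends are prescribed through chosen isomorphisms). -/
structure DExtension (d : ℕ) (A B : M) where
  seq : ComposableArrows M (d + 1)
  isDExact : IsDExact seq
  left : seq.obj' 0 ≅ A
  right : seq.obj' (d + 1) ≅ B

/-- There is a morphism of `d`-exact sequences from `E` to `E'` that is the identity on both ends. -/
def DExtension.Step {d : ℕ} {A B : M} (E E' : DExtension d A B) : Prop :=
  ∃ φ : E.seq ⟶ E'.seq,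
    ComposableArrows.app' φ 0 ≫ E'.left.hom = E.left.hom ∧
      ComposableArrows.app' φ (d + 1) ≫ E'.right.hom = E.right.hom

/-- Yoneda equivalence of `d`-exact sequences with the same ends: the equivalence relation
generated by the morphisms that are the identity on both ends. -/
def DExtension.YonedaEquivalent {d : ℕ} {A B : M} (E E' : DExtension d A B) : Prop :=
  Relation.EqvGen DExtension.Step E E'

/-- Wide subcategories (for a given `d`): additive subcategories closed under `d`-kernels,
`d`-cokernels and `d`-extensions. -/
structure IsWide (d : ℕ) (W : ObjectProperty M) : Prop where
  additive : IsAdditiveSubcategory W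
  kernel : ∀ {X Y : M} (g : X ⟶ Y), W X → W Y →
    ∃ S : ComposableArrows M (d + 1), IsDKernel S ∧
      Nonempty (Arrow.mk (S.map' d (d + 1)) ≅ Arrow.mk g) ∧ ∀ i, W (S.obj i)
  cokernel : ∀ {X Y : M} (g : X ⟶ Y), W X → W Y →
    ∃ S : ComposableArrows M (d + 1), IsDCokernel S ∧
      Nonempty (Arrow.mk (S.map' 0 1) ≅ Arrow.mk g) ∧ ∀ i, W (S.obj i)
  extension : ∀ {A B : M} (E : DExtension d A B), W A → W B →
    ∃ E' : DExtension d A B, DExtension.YonedaEquivalent E E' ∧ ∀ i, W (E'.seq.obj i)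

/-- A category is semisimple if the endomorphism ring of each object is semisimple. -/
def IsSemisimpleCategory (C : Type u) [Category.{v} C] [Preadditive C] : Prop :=
  ∀ X : C, IsSemisimpleRing (End X)

end HigherHomological

/-! ### The path algebra of a quiver with finitely many vertices -/

/-- Elements of the path algebra `kQ`: families `x` where `x a b` is a finite `k`-linear
combination of paths from `a` to `b`. -/
def PathAlgebra (k : Type u) (Q : Type v) [Semiring k] [Quiver.{w} Q] :=
  ∀ a b : Q, Quiver.Path a b →₀ k

namespace PathAlgebra

noncomputable section

variable {k : Type u} {Q : Type v} [CommRing k] [Quiver.{w} Q]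

instance : AddCommGroup (PathAlgebra k Q) :=
  inferInstanceAs (AddCommGroup (∀ a b : Q, Quiver.Path a b →₀ k))

instance : Module k (PathAlgebra k Q) :=
  inferInstanceAs (Module k (∀ a b : Q, Quiver.Path a b →₀ k))

@[ext] theorem ext {x y : PathAlgebra k Q} (h : ∀ a b, x a b = y a b) : x = y :=
  funext fun a => funext fun b => h a b

@[simp] theorem add_apply (x y : PathAlgebra k Q) (a b : Q) : (x + y) a b = x a b + y a b := rfl

@[simp] theorem zero_apply (a b : Q) : (0 : PathAlgebra k Q) a b = 0 := rfl

@[simp] theorem smul_apply (r : k) (x : PathAlgebra k Q) (a b : Q) :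
    (r • x) a b = r • x a b := rfl

/-- Bilinear extension of the concatenation of paths: first a path `a → b`, then a path `b → c`. -/
def concat (k : Type u) {Q : Type v} [CommRing k] [Quiver.{w} Q] (a b c : Q) :
    (Quiver.Path a b →₀ k) →ₗ[k] (Quiver.Path b c →₀ k) →ₗ[k] (Quiver.Path a c →₀ k) :=
  Finsupp.lsum k fun p => LinearMap.toSpanSingleton k _ (Finsupp.lmapDomain k k fun q => p.comp q)

@[simp] theorem concat_single (a b c : Q) (p : Quiver.Path a b) (q : Quiver.Path b c) (r s : k) :
    concat k a b c (Finsupp.single p r) (Finsupp.single q s) =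
      Finsupp.single (p.comp q) (r * s) := by
  simp [concat]

theorem concat_assoc (a b c e : Q) (x : Quiver.Path a b →₀ k) (y : Quiver.Path b c →₀ k)
    (z : Quiver.Path c e →₀ k) :
    concat k a c e (concat k a b c x y) z = concat k a b e x (concat k b c e y z) := by
  induction x using Finsupp.induction_linear with
  | zero => simp
  | add x x' hx hx' => simp [hx, hx']
  | single p r =>
    induction y using Finsupp.induction_linear with
    | zero => simp
    | add y y' hy hy' => simp [hy, hy']
    | single q s =>
      induction z using Finsupp.induction_linear with
      | zero => simp
      | add z z' hz hz' => rw [map_add, map_add, map_add, hz, hz']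
      | single t l => simp only [concat_single, Quiver.Path.comp_assoc, mul_assoc]

theorem nil_concat (a b : Q) (x : Quiver.Path a b →₀ k) :
    concat k a a b (Finsupp.single Quiver.Path.nil 1) x = x := by
  induction x using Finsupp.induction_linear with
  | zero => simp
  | add x x' hx hx' => simp [hx, hx']
  | single p r => simp

theorem concat_nil (a b : Q) (x : Quiver.Path a b →₀ k) :
    concat k a b b x (Finsupp.single Quiver.Path.nil 1) = x := by
  induction x using Finsupp.induction_linear with
  | zero => simp
  | add x x' hx hx' => simp [hx, hx']
  | single p r => simp

section

variable [Fintype Q]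

/-- Multiplication is matrix multiplication with respect to concatenation of paths. -/
instance : Mul (PathAlgebra k Q) where
  mul x y := fun a c => ∑ b : Q, concat k a b c (x a b) (y b c)

theorem mul_apply (x y : PathAlgebra k Q) (a c : Q) :
    (x * y) a c = ∑ b : Q, concat k a b c (x a b) (y b c) := rfl

end

variable [DecidableEq Q]

/-- The stationary path `e_v`, an idempotent of the path algebra. -/
def idem (k : Type u) {Q : Type v} [CommRing k] [Quiver.{w} Q] [DecidableEq Q] (v : Q) : PathAlgebra k Q :=
  fun a b => if h : a = v ∧ v = b then Finsupp.single (h.1 ▸ h.2 ▸ Quiver.Path.nil) 1 else 0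

instance : One (PathAlgebra k Q) where
  one := fun a b => if h : a = b then Finsupp.single (h ▸ Quiver.Path.nil) 1 else 0

theorem one_apply_self (a : Q) :
    (1 : PathAlgebra k Q) a a = Finsupp.single Quiver.Path.nil 1 := by
  change (dite _ _ _) = _
  simp

theorem one_apply_ne {a b : Q} (h : a ≠ b) : (1 : PathAlgebra k Q) a b = 0 := by
  change (dite _ _ _) = _
  simp [h]

variable [Fintype Q]

instance : Ring (PathAlgebra k Q) where
  __ := (inferInstance : AddCommGroup (PathAlgebra k Q))
  left_distrib x y z := by ext1 a c; simp [mul_apply, Finset.sum_add_distrib]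
  right_distrib x y z := by ext1 a c; simp [mul_apply, Finset.sum_add_distrib]
  zero_mul x := by ext1 a c; simp [mul_apply]
  mul_zero x := by ext1 a c; simp [mul_apply]
  mul_assoc x y z := by
    ext1 a e
    simp only [mul_apply, map_sum, LinearMap.sum_apply, concat_assoc]
    exact Finset.sum_comm
  one_mul x := by
    ext1 a b
    rw [mul_apply, Finset.sum_eq_single a, one_apply_self, nil_concat]
    · intro c _ hc
      rw [one_apply_ne (Ne.symm hc)]; simp
    · simp
  mul_one x := by
    ext1 a b
    rw [mul_apply, Finset.sum_eq_single b, one_apply_self, concat_nil]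
    · intro c _ hc
      rw [one_apply_ne hc]; simp
    · simp

instance : Algebra k (PathAlgebra k Q) :=
  Algebra.ofModule
    (fun r x y => by ext1 a b; simp [mul_apply, Finset.smul_sum])
    (fun r x y => by ext1 a b; simp [mul_apply, Finset.smul_sum])

end

end PathAlgebra

/-! ### The algebra `Φ = kQ / (rad kQ)^ℓ` for the quiver `m → ⋯ → 2 → 1` -/

/-- The vertices `1, …, m` of the quiver `m → ⋯ → 2 → 1`. -/
def LinearQuiver (m : ℕ) : Type := {i : ℕ // i ∈ Finset.Icc 1 m}

instance (m : ℕ) : DecidableEq (LinearQuiver m) :=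
  inferInstanceAs (DecidableEq {i : ℕ // i ∈ Finset.Icc 1 m})

instance (m : ℕ) : Fintype (LinearQuiver m) :=
  inferInstanceAs (Fintype {i : ℕ // i ∈ Finset.Icc 1 m})

/-- There is exactly one arrow `i + 1 → i` for all `1 ≤ i < m`, and there are no other arrows. -/
instance (m : ℕ) : Quiver (LinearQuiver m) where
  Hom a b := PLift (a.1 = b.1 + 1)

noncomputable section

/-- The algebra `Φ = kQ / (rad kQ)^ℓ`. -/
abbrev NakayamaAlgebra (k : Type u) [Field k] (m ℓ : ℕ) : Type u :=
  PathAlgebra k (LinearQuiver m) ⧸ (Ring.jacobson (PathAlgebra k (LinearQuiver m))) ^ ℓ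

/-- The idempotent of `Φ` at the vertex `i` (and `0` if `i` is not one of the vertices). -/
def NakayamaAlgebra.e (k : Type u) [Field k] (m ℓ i : ℕ) : NakayamaAlgebra k m ℓ :=
  if h : i ∈ Finset.Icc 1 m then
    Ideal.Quotient.mk _ (PathAlgebra.idem k (⟨i, h⟩ : LinearQuiver m)) else 0

/-- The dual `D N = Hom_k(N, k)` of a left `A`-module `N`. -/
def DualModule (k : Type u) (A : Type v) (N : Type w) [Field k] [Ring A] [Algebra k A]
    [AddCommGroup N] [Module k N] [Module A N] [IsScalarTower k A N] : Type (max u w) :=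
  N →ₗ[k] k

namespace DualModule

variable (k : Type u) (A : Type v) (N : Type w) [Field k] [Ring A] [Algebra k A]
  [AddCommGroup N] [Module k N] [Module A N] [IsScalarTower k A N]

instance : AddCommGroup (DualModule k A N) := inferInstanceAs (AddCommGroup (N →ₗ[k] k))

variable {k A N} in
/-- An element of `D N` as a linear form on `N`. -/
def toForm (f : DualModule k A N) : N →ₗ[k] k := f

/-- The right `A`-module structure on `Hom_k(N, k)`: `(f a) x = f (a x)`. -/
instance : Module Aᵐᵒᵖ (DualModule k A N) where
  smul a f := f.toForm ∘ₗ Algebra.lsmul k k N a.unop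
  one_smul f := LinearMap.ext fun x => congrArg f.toForm (one_smul A x)
  mul_smul a b f := LinearMap.ext fun x => congrArg f.toForm (mul_smul b.unop a.unop x)
  smul_zero _ := LinearMap.ext fun _ => rfl
  smul_add _ _ _ := LinearMap.ext fun _ => rfl
  add_smul a b f := LinearMap.ext fun x =>
    (congrArg f.toForm (add_smul a.unop b.unop x)).trans (map_add f.toForm _ _)
  zero_smul f := LinearMap.ext fun x =>
    (congrArg f.toForm (zero_smul A x)).trans (map_zero f.toForm)

end DualModule

/-- The category of right `Φ`-modules. -/
abbrev RightMod (k : Type u) [Field k] (m ℓ : ℕ) := ModuleCat.{u} (NakayamaAlgebra k m ℓ)ᵐᵒᵖ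

/-- The indecomposable projective right module `p_i = e_i Φ`. -/
def projMod (k : Type u) [Field k] (m ℓ i : ℕ) : RightMod k m ℓ :=
  ModuleCat.of _ (Submodule.span (NakayamaAlgebra k m ℓ)ᵐᵒᵖ {NakayamaAlgebra.e k m ℓ i})

/-- The indecomposable injective right module `q_i = D(Φ e_i)`. -/
def injMod (k : Type u) [Field k] (m ℓ i : ℕ) : RightMod k m ℓ :=
  ModuleCat.of _ (DualModule k (NakayamaAlgebra k m ℓ)
    (Submodule.span (NakayamaAlgebra k m ℓ) {NakayamaAlgebra.e k m ℓ i}))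

/-- The indices `1, …, m + ℓ - 1` of the modules `f_i`. -/
abbrev Idx (m ℓ : ℕ) : Type := {i : ℕ // i ∈ Finset.Icc 1 (m + ℓ - 1)}

/-- `f_i = p_i` for `1 ≤ i ≤ m` and `f_i = q_{i - ℓ + 1}` for `m + 1 ≤ i ≤ m + ℓ - 1`. -/
def fMod (k : Type u) [Field k] (m ℓ : ℕ) (i : Idx m ℓ) : RightMod k m ℓ :=
  if i.1 ≤ m then projMod k m ℓ i.1 else injMod k m ℓ (i.1 + 1 - ℓ)

/-- `f = f_1 ⊕ ⋯ ⊕ f_{m + ℓ - 1}`. -/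
def fSum (k : Type u) [Field k] (m ℓ : ℕ) : RightMod k m ℓ :=
  ModuleCat.of _ (∀ i : Idx m ℓ, fMod k m ℓ i)

/-- `add (g)`: the direct summands of the finite direct sums `gⁿ`. -/
def addClosure {R : Type u} [Ring R] (g : ModuleCat.{v} R) : ObjectProperty (ModuleCat.{v} R) :=
  fun X => ∃ n : ℕ, Nonempty (Retract X (ModuleCat.of R (Fin n → g)))

/-- `𝓕 = add (f)` as a full subcategory of the category of right `Φ`-modules (all its objects
are finitely generated). -/
abbrev FCat (k : Type u) [Field k] (m ℓ : ℕ) := (addClosure (fSum k m ℓ)).FullSubcategory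

theorem fMod_mem (k : Type u) [Field k] (m ℓ : ℕ) (i : Idx m ℓ) :
    addClosure (fSum k m ℓ) (fMod k m ℓ i) :=
  ⟨1, ⟨{
    i := ModuleCat.ofHom (LinearMap.pi fun _ =>
      LinearMap.single (NakayamaAlgebra k m ℓ)ᵐᵒᵖ (fun j => fMod k m ℓ j) i)
    r := ModuleCat.ofHom ((LinearMap.proj (R := (NakayamaAlgebra k m ℓ)ᵐᵒᵖ)
      (φ := fun j => fMod k m ℓ j) i) ∘ₗ LinearMap.proj (0 : Fin 1))
    retract := by
      ext x
      exact Pi.single_eq_same (M := fun j => fMod k m ℓ j) i x }⟩⟩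

/-- `f_i` as an object of `𝓕`. -/
def fObj (k : Type u) [Field k] (m ℓ : ℕ) (i : Idx m ℓ) : FCat k m ℓ :=
  ⟨fMod k m ℓ i, fMod_mem k m ℓ i⟩

end

/-!
Write `m - 1 = Dℓ` and `d = 2D`, so that the number of the objects `f_i` is `N = (D + 1)ℓ`.

Every `f_i` is the interval module with support `{a | i - ℓ < a ≤ i}` (`IntervalCoord`), because the
radical of the path algebra consists of the strictly triangular matrices
(`PathAlgebra.jacobson_pow_eq`). Hence `Hom (f_i, f_j)` is spanned by a canonical morphism, which is
nonzero exactly for `i ≤ j < i + ℓ`, and these morphisms compose to each other: `𝓕` is the category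
generated by the linear quiver `1 ⟶ 2 ⟶ ⋯ ⟶ N` modulo paths of length `ℓ` (`NakayamaFamily`,
`NakayamaAlgebra.family`). Semisimplicity, `d`-kernels, `d`-cokernels and `d`-exact sequences only
depend on the category `𝓕`, so the rest of the argument takes place in a `NakayamaFamily`.

If `W` is semisimple, every morphism `g` in `W` is regular, `g h g = g` for some `h`. The canonical
morphism `f_i ⟶ f_j` with `i < j < i + ℓ` is not regular, so the indices in `W` are at least `ℓ`
apart. If `j = i + Dℓ + r` with `r > 0`, the sequence
`f_i ⟶ f_{i+r} ⟶ f_{i+ℓ} ⟶ f_{i+ℓ+r} ⟶ ⋯ ⟶ f_{i+Dℓ} ⟶ f_j` is `d`-exact and does not split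
(`NakayamaFamily.staircase`). Being split is invariant under Yoneda equivalence
(`DExtension.YonedaEquivalent.isSplit_iff`), and a `d`-exact sequence in `W` splits, its first
morphism being a regular monomorphism. So `W` is not closed under `d`-extensions in this case.

Conversely, suppose that the indices in `W` satisfy the bounds. Objects of `W` are summands of sums
of objects `f_i` in `W` (`NakayamaFamily.exists_sum_mem`), there are no nonzero morphisms between
different such `f_i`, and so `End X` is a product of endomorphism rings of vector spaces. Regular
morphisms have kernels and cokernels which are direct summands, and extended by zero objects these
are `d`-kernels and `d`-cokernels. Finally, every `d`-exact sequence `S` with ends in `W` splits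
(`NakayamaFamily.isSplit`), and then it is Yoneda equivalent to a sequence
`A ⟶ A ⟶ 0 ⟶ ⋯ ⟶ 0 ⟶ B ⟶ B`. For the splitting, a morphism from `f_j` to the last term of `S` has
to be lifted. For `j ≤ Dℓ + 1` the duality `Hom (f_j, X) ≅ Hom (X, f_{j+ℓ-1})^*` turns this into the
fact that the last morphism of `S` is an epimorphism. For `j = Dℓ + 1 + s` with `s > 0` one compares
the sequence above for `i = 1`, `r = s` with `S`: as the indices in `W` are at least
`j - Dℓ = 1 + s`, all morphisms from `f_1` to the first term of `S` factor through `f_{1+s}`, so the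
comparison is null-homotopic (`exists_lift_of_comparison`).
-/

/-! ### Regular morphisms and split idempotents -/

section Regular

variable {M : Type u} [Category.{v} M] [Preadditive M]

/-- A retract is a direct summand as soon as idempotents split. -/
theorem IsAdditiveSubcategory.of_retract [IsIdempotentComplete M] {W : ObjectProperty M}
    (hW : IsAdditiveSubcategory W) {X Y : M} (i : Y ⟶ X) (r : X ⟶ Y) (h : i ≫ r = 𝟙 Y)
    (hX : W X) : W Y := by
  obtain ⟨Z, j, e, hje, hej⟩ := IsIdempotentComplete.idempotents_split X (𝟙 X - r ≫ i) (by
    simp [Preadditive.sub_comp, Preadditive.comp_sub, reassoc_of% h])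
  have hj : j ≫ r = 0 := by
    rw [← cancel_epi (𝟙 Z), ← hje]
    simp only [Category.assoc, reassoc_of% hej]
    simp [Preadditive.sub_comp, h]
  have he : i ≫ e = 0 := by
    rw [← cancel_mono (𝟙 Z), ← hje]
    simp only [Category.assoc, reassoc_of% hej]
    simp [Preadditive.sub_comp, reassoc_of% h]
  let b : Limits.BinaryBicone Y Z :=
    { pt := X, fst := r, snd := e, inl := i, inr := j
      inl_fst := h, inl_snd := he, inr_fst := hj, inr_snd := hje }
  refine (hW.summand b (Limits.isBinaryBilimitOfTotal b ?_) hX).1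
  change r ≫ i + e ≫ j = 𝟙 X
  rw [hej]; abel

/-- Semisimple rings are von Neumann regular. -/
theorem IsSemisimpleRing.exists_mul_mul_eq {R : Type*} [Ring R] [IsSemisimpleRing R] (a : R) :
    ∃ x, a * x * a = a := by
  obtain ⟨e, he, h⟩ := IsSemisimpleRing.ideal_eq_span_idempotent (Ideal.span {a})
  obtain ⟨y, hy⟩ := Ideal.mem_span_singleton'.1 (h ▸ Ideal.mem_span_singleton_self a)
  obtain ⟨x, hx⟩ := Ideal.mem_span_singleton'.1 (h ▸ Ideal.mem_span_singleton_self e)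
  exact ⟨x, by rw [mul_assoc, hx, ← hy, mul_assoc, he.eq]⟩

/-- In a semisimple additive subcategory every morphism `g` is regular: apply regularity of
`End (X ⊞ Y)` to `g`, viewed as an endomorphism of `X ⊞ Y`. -/
theorem IsAdditiveSubcategory.exists_comp_comp_eq [Limits.HasBinaryBiproducts M]
    {W : ObjectProperty M} (hW : IsAdditiveSubcategory W)
    (hs : IsSemisimpleCategory W.FullSubcategory) {X Y : M} (hX : W X) (hY : W Y) (g : X ⟶ Y) :
    ∃ h : Y ⟶ X, g ≫ h ≫ g = g := by
  open Limits in
  have hZ : W (X ⊞ Y) := hW.sum _ (BinaryBiproduct.isBilimit X Y) hX hY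
  have := hs ⟨X ⊞ Y, hZ⟩
  obtain ⟨x, hx⟩ := IsSemisimpleRing.exists_mul_mul_eq
    (R := End (⟨X ⊞ Y, hZ⟩ : W.FullSubcategory))
    (ObjectProperty.homMk (biprod.fst ≫ g ≫ biprod.inr))
  refine ⟨biprod.inr ≫ x.hom ≫ biprod.fst, ?_⟩
  have h2 : (biprod.fst ≫ g ≫ biprod.inr) ≫ x.hom ≫ (biprod.fst ≫ g ≫ biprod.inr) =
      (biprod.fst ≫ g ≫ biprod.inr : X ⊞ Y ⟶ X ⊞ Y) :=
    congrArg (fun t : End (⟨X ⊞ Y, hZ⟩ : W.FullSubcategory) => t.hom) hx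
  have h3 := congrArg (fun t => biprod.inl ≫ t ≫ biprod.snd) h2
  simpa using h3

end Regular

/-! ### Higher kernels and cokernels of regular morphisms -/

section Regular

variable {M : Type u} [Category.{v} M] [Preadditive M]

theorem IsDKernel.comp_eq_zero {d : ℕ} {S : ComposableArrows M (d + 1)} (hS : IsDKernel S)
    (i : ℕ) (hi : i < d) : S.map' i (i + 1) ≫ S.map' (i + 1) (i + 2) = 0 :=
  (hS.exact i hi _ _).2 ⟨𝟙 _, Category.id_comp _⟩

theorem IsDCokernel.comp_eq_zero {d : ℕ} {S : ComposableArrows M (d + 1)} (hS : IsDCokernel S)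
    (i : ℕ) (hi : i < d) : S.map' i (i + 1) ≫ S.map' (i + 1) (i + 2) = 0 :=
  (hS.exact i hi _ _).2 ⟨𝟙 _, Category.comp_id _⟩

/-- A regular morphism in `W` has a `d`-kernel `0 ⟶ ⋯ ⟶ 0 ⟶ K ⟶ X` in `W`. -/
theorem IsAdditiveSubcategory.exists_isDKernel [IsIdempotentComplete M] [Limits.HasZeroObject M]
    {W : ObjectProperty M} (hW : IsAdditiveSubcategory W) {X Y : M} (hX : W X) (hY : W Y)
    (g : X ⟶ Y) (hg : ∃ h : Y ⟶ X, g ≫ h ≫ g = g) (e : ℕ) :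
    ∃ S : ComposableArrows M (e + 1 + 1), IsDKernel S ∧
      Nonempty (Arrow.mk (S.map' (e + 1) (e + 1 + 1)) ≅ Arrow.mk g) ∧ ∀ i, W (S.obj i) := by
  induction e with
  | zero =>
    obtain ⟨h, hg⟩ := hg
    obtain ⟨K, i, p, hip, hpi⟩ := IsIdempotentComplete.idempotents_split X (𝟙 X - g ≫ h) (by
      simp [Preadditive.sub_comp, Preadditive.comp_sub, reassoc_of% hg])
    have hig : i ≫ g = 0 := by
      rw [← cancel_epi (𝟙 K), ← hip]
      simp only [Category.assoc, reassoc_of% hpi]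
      simp [Preadditive.sub_comp, hg]
    refine ⟨ComposableArrows.mk₂ i g, ⟨?_, ?_⟩, ⟨Iso.refl _⟩, ?_⟩
    · intro T f hf
      change T ⟶ K at f
      have hf : f ≫ i = 0 := hf
      rw [← Category.comp_id f, ← hip, reassoc_of% hf, Limits.zero_comp]
      rfl
    · intro j hj T f
      obtain rfl : j = 0 := by omega
      change T ⟶ X at f
      change f ≫ g = 0 ↔ ∃ q : T ⟶ K, q ≫ i = f
      refine ⟨fun h0 => ⟨f ≫ p, ?_⟩, ?_⟩
      · rw [Category.assoc, hpi, Preadditive.comp_sub, reassoc_of% h0]; simp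
      · rintro ⟨q, rfl⟩; rw [Category.assoc, hig, Limits.comp_zero]
    · intro j
      match j with
      | ⟨0, _⟩ => exact hW.of_retract i p hip hX
      | ⟨1, _⟩ => exact hX
      | ⟨2, _⟩ => exact hY
  | succ e ih =>
    obtain ⟨S, hS, hiso, hSW⟩ := ih
    obtain ⟨O, z⟩ := Limits.HasZeroObject.zero (C := M)
    refine ⟨S.precomp (0 : O ⟶ S.left), ⟨?_, ?_⟩, hiso, ?_⟩
    · intro T f _
      exact z.eq_of_tgt f 0
    · intro j hj T f
      match j with
      | 0 =>
        change T ⟶ S.obj' 0 at f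
        change f ≫ S.map' 0 1 = 0 ↔ ∃ q : T ⟶ O, q ≫ 0 = f
        refine ⟨fun h0 => ⟨0, ?_⟩, ?_⟩
        · rw [hS.injective T f h0]; exact Limits.zero_comp
        · rintro ⟨q, rfl⟩
          exact (congrArg (· ≫ S.map' 0 1) Limits.comp_zero).trans Limits.zero_comp
      | j + 1 => exact hS.exact j (by omega) T f
    · intro j
      match j with
      | ⟨0, _⟩ => exact hW.zero z
      | ⟨j + 1, hj⟩ => exact hSW ⟨j, by omega⟩

/-- A regular morphism in `W` has a `d`-cokernel `Y ⟶ C ⟶ 0 ⟶ ⋯ ⟶ 0` in `W`. -/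
theorem IsAdditiveSubcategory.exists_isDCokernel [IsIdempotentComplete M]
    [Limits.HasZeroObject M]
    {W : ObjectProperty M} (hW : IsAdditiveSubcategory W) {X Y : M} (hX : W X) (hY : W Y)
    (g : X ⟶ Y) (hg : ∃ h : Y ⟶ X, g ≫ h ≫ g = g) (e : ℕ) :
    ∃ S : ComposableArrows M (e + 2 + 1), IsDCokernel S ∧
      Nonempty (Arrow.mk (S.map' 0 1) ≅ Arrow.mk g) ∧ ∀ i, W (S.obj i) := by
  obtain ⟨h, hg⟩ := hg
  obtain ⟨K, i, p, hip, hpi⟩ := IsIdempotentComplete.idempotents_split Y (𝟙 Y - h ≫ g) (by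
    simp [Preadditive.sub_comp, Preadditive.comp_sub, hg])
  have hgp : g ≫ p = 0 := by
    rw [← cancel_mono (𝟙 K), ← hip]
    simp only [Category.assoc, reassoc_of% hpi]
    simp [Preadditive.sub_comp, Preadditive.comp_sub, reassoc_of% hg]
  obtain ⟨O, z⟩ := Limits.HasZeroObject.zero (C := M)
  let Z : ComposableArrows M e := (Functor.const _).obj O
  refine ⟨((Z.precomp (0 : K ⟶ Z.left)).precomp p).precomp g, ⟨?_, ?_⟩, ⟨Iso.refl _⟩, ?_⟩
  · intro T f _
    exact z.eq_of_src f 0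
  · intro j hj T f
    match j with
    | 0 =>
      change Y ⟶ T at f
      change g ≫ f = 0 ↔ ∃ q : K ⟶ T, p ≫ q = f
      refine ⟨fun h0 => ⟨i ≫ f, ?_⟩, ?_⟩
      · rw [← Category.assoc, hpi, Preadditive.sub_comp, Category.assoc, h0]; simp
      · rintro ⟨q, rfl⟩; rw [reassoc_of% hgp, Limits.zero_comp]
    | 1 =>
      change K ⟶ T at f
      change p ≫ f = 0 ↔ ∃ q : O ⟶ T, 0 ≫ q = f
      refine ⟨fun h0 => ⟨0, ?_⟩, ?_⟩
      · rw [← Category.id_comp f, ← hip, Category.assoc, h0]; simp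
      · rintro ⟨q, rfl⟩; simp
    | j + 2 =>
      change O ⟶ T at f
      exact ⟨fun _ => ⟨0, z.eq_of_src _ _⟩,
        fun _ => (congrArg (_ ≫ ·) (z.eq_of_src f 0)).trans Limits.comp_zero⟩
  · intro j
    match j with
    | ⟨0, _⟩ => exact hX
    | ⟨1, _⟩ => exact hY
    | ⟨2, _⟩ => exact hW.of_retract i p hip hY
    | ⟨j + 3, hj⟩ => exact hW.zero z

end Regular

/-! ### Split higher extensions -/

section Split

variable {M : Type u} [Category.{v} M] [Preadditive M]

/-- A `d`-exact sequence whose first morphism is a split monomorphism ends with a split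
epimorphism: regularity propagates from each morphism of the sequence to the next. -/
theorem IsDCokernel.exists_section {d : ℕ} {S : ComposableArrows M (d + 1)} (hS : IsDCokernel S)
    (r : S.obj' 1 ⟶ S.obj' 0) (hr : S.map' 0 1 ≫ r = 𝟙 _) :
    ∃ s : S.obj' (d + 1) ⟶ S.obj' d, s ≫ S.map' d (d + 1) = 𝟙 _ := by
  have key : ∀ (i : ℕ) (hi : i ≤ d), ∃ h : S.obj' (i + 1) ⟶ S.obj' i,
      S.map' i (i + 1) ≫ h ≫ S.map' i (i + 1) = S.map' i (i + 1) := by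
    intro i
    induction i with
    | zero => exact fun _ => ⟨r, by rw [reassoc_of% hr]⟩
    | succ i ih =>
      intro hi
      obtain ⟨h, hh⟩ := ih (by omega)
      obtain ⟨h', hh'⟩ := (hS.exact i (by omega) _ (𝟙 _ - h ≫ S.map' i (i + 1))).1 (by
        rw [Preadditive.comp_sub, hh, Category.comp_id, sub_self])
      refine ⟨h', ?_⟩
      rw [reassoc_of% hh', Preadditive.sub_comp, Category.assoc, hS.comp_eq_zero i (by omega)]
      simp
  obtain ⟨h, hh⟩ := key d le_rfl
  refine ⟨h, sub_eq_zero.1 (hS.injective _ _ ?_)⟩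
  rw [Preadditive.comp_sub, hh, Category.comp_id, sub_self]

/-- The dual of `IsDCokernel.exists_section`. -/
theorem IsDKernel.exists_retraction {d : ℕ} {S : ComposableArrows M (d + 1)} (hS : IsDKernel S)
    (s : S.obj' (d + 1) ⟶ S.obj' d) (hs : s ≫ S.map' d (d + 1) = 𝟙 _) :
    ∃ r : S.obj' 1 ⟶ S.obj' 0, S.map' 0 1 ≫ r = 𝟙 _ := by
  have key : ∀ (j i : ℕ) (hi : i + j = d), ∃ h : S.obj' (i + 1) ⟶ S.obj' i,
      S.map' i (i + 1) ≫ h ≫ S.map' i (i + 1) = S.map' i (i + 1) := by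
    intro j
    induction j with
    | zero =>
      intro i hi
      obtain rfl : i = d := hi
      exact ⟨s, by rw [hs, Category.comp_id]⟩
    | succ j ih =>
      intro i hi
      obtain ⟨h, hh⟩ := ih (i + 1) (by omega)
      obtain ⟨h', hh'⟩ := (hS.exact i (by omega) _ (𝟙 _ - S.map' (i + 1) (i + 2) ≫ h)).1 (by
        rw [Preadditive.sub_comp, Category.assoc, hh, Category.id_comp, sub_self])
      refine ⟨h', ?_⟩
      rw [hh', Preadditive.comp_sub, reassoc_of% hS.comp_eq_zero i (by omega)]
      simp
  obtain ⟨h, hh⟩ := key d 0 (by omega)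
  refine ⟨h, sub_eq_zero.1 (hS.injective _ _ ?_)⟩
  rw [Preadditive.sub_comp, Category.assoc, hh, Category.id_comp, sub_self]

/-- A `d`-exact sequence `0 ⟶ A ⟶ S₁ ⟶ ⋯ ⟶ S_d ⟶ B ⟶ 0` is split if its first morphism is a split
monomorphism. -/
def DExtension.IsSplit {d : ℕ} {A B : M} (E : DExtension d A B) : Prop :=
  ∃ r : E.seq.obj' 1 ⟶ E.seq.obj' 0, E.seq.map' 0 1 ≫ r = 𝟙 _

theorem DExtension.isSplit_iff {d : ℕ} {A B : M} (E : DExtension d A B) :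
    E.IsSplit ↔ ∃ s : E.seq.obj' (d + 1) ⟶ E.seq.obj' d, s ≫ E.seq.map' d (d + 1) = 𝟙 _ :=
  ⟨fun ⟨r, hr⟩ => E.isDExact.cokernel.exists_section r hr,
    fun ⟨s, hs⟩ => E.isDExact.kernel.exists_retraction s hs⟩

/-- A retraction of the first morphism is pulled back along a morphism of extensions, and a
section of the last morphism is pushed forward. -/
theorem DExtension.Step.isSplit_iff {d : ℕ} {A B : M} {E E' : DExtension d A B}
    (h : E.Step E') : E.IsSplit ↔ E'.IsSplit := by
  obtain ⟨φ, hl, hr⟩ := h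
  constructor
  · intro hE
    obtain ⟨s, hs⟩ := E.isSplit_iff.1 hE
    refine E'.isSplit_iff.2
      ⟨E'.right.hom ≫ E.right.inv ≫ s ≫ ComposableArrows.app' φ d, ?_⟩
    rw [Category.assoc, Category.assoc, Category.assoc,
      ← ComposableArrows.naturality' φ d (d + 1), reassoc_of% hs, ← cancel_mono E'.right.hom]
    simp only [Category.assoc, hr]
    simp
  · rintro ⟨r, hr'⟩
    refine ⟨ComposableArrows.app' φ 1 ≫ r ≫ E'.left.hom ≫ E.left.inv, ?_⟩
    rw [ComposableArrows.naturality'_assoc φ 0 1, reassoc_of% hr', reassoc_of% hl]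
    exact E.left.hom_inv_id

theorem DExtension.YonedaEquivalent.isSplit_iff {d : ℕ} {A B : M} {E E' : DExtension d A B}
    (h : E.YonedaEquivalent E') : E.IsSplit ↔ E'.IsSplit := by
  induction h with
  | rel _ _ h => exact h.isSplit_iff
  | refl => rfl
  | symm _ _ _ ih => exact ih.symm
  | trans _ _ _ _ _ ih ih' => exact ih.trans ih'

end Split

/-! ### The split extension with zero middle part -/

section Trivial

variable {M : Type u} [Category.{v} M] [Preadditive M]

/-- The sequence `0 ⟶ ⋯ ⟶ 0 ⟶ B ⟶ B`. -/
theorem IsAdditiveSubcategory.exists_zero_id [Limits.HasZeroObject M]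
    {W : ObjectProperty M} (hW : IsAdditiveSubcategory W) {B : M} (hB : W B) (e : ℕ) :
    ∃ S : ComposableArrows M (e + 1), Nonempty (S.obj' (e + 1) ≅ B) ∧
      IsIso (S.map' e (e + 1)) ∧ (∀ (i : ℕ) (hi : i < e), Limits.IsZero (S.obj' i)) ∧
      ∀ i, W (S.obj i) := by
  induction e with
  | zero =>
    refine ⟨ComposableArrows.mk₁ (𝟙 B), ⟨Iso.refl _⟩, inferInstanceAs (IsIso (𝟙 B)),
      fun i hi => by omega, fun i => ?_⟩
    match i with
    | ⟨0, _⟩ => exact hB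
    | ⟨1, _⟩ => exact hB
  | succ e ih =>
    obtain ⟨S, hSB, hiso, hz, hSW⟩ := ih
    obtain ⟨O, z⟩ := Limits.HasZeroObject.zero (C := M)
    refine ⟨S.precomp (0 : O ⟶ S.left), hSB, hiso, fun i hi => ?_, fun i => ?_⟩
    · match i with
      | 0 => exact z
      | i + 1 => exact hz i (by omega)
    · match i with
      | ⟨0, _⟩ => exact hW.zero z
      | ⟨i + 1, hi⟩ => exact hSW ⟨i, by omega⟩

/-- The sequence `A ⟶ A ⟶ 0 ⟶ ⋯ ⟶ 0 ⟶ B ⟶ B`, described through its properties. -/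
theorem IsAdditiveSubcategory.exists_id_zero_id [Limits.HasZeroObject M]
    {W : ObjectProperty M} (hW : IsAdditiveSubcategory W) {A B : M} (hA : W A) (hB : W B)
    (e : ℕ) :
    ∃ S : ComposableArrows M (e + 2 + 1),
      Nonempty (S.obj' 0 ≅ A) ∧ Nonempty (S.obj' (e + 2 + 1) ≅ B) ∧
      IsIso (S.map' 0 1) ∧ IsIso (S.map' (e + 2) (e + 2 + 1)) ∧
      S.map' 1 2 = 0 ∧ S.map' (e + 1) (e + 2) = 0 ∧
      (∀ (i : ℕ) (hi : i < e), Limits.IsZero (S.obj' (i + 2))) ∧ ∀ i, W (S.obj i) := by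
  obtain ⟨S, hSB, hiso, hz, hSW⟩ := hW.exists_zero_id hB e
  refine ⟨(S.precomp (0 : A ⟶ S.left)).precomp (𝟙 A), ⟨Iso.refl _⟩, hSB,
    inferInstanceAs (IsIso (𝟙 A)), hiso, rfl, ?_, hz, fun i => ?_⟩
  · match e with
    | 0 => rfl
    | e + 1 => exact (hz e (by omega)).eq_of_src _ _
  · match i with
    | ⟨0, _⟩ => exact hA
    | ⟨1, _⟩ => exact hA
    | ⟨i + 2, hi⟩ => exact hSW ⟨i, by omega⟩

theorem isDExact_of_id_zero_id {e : ℕ} (S : ComposableArrows M (e + 2 + 1))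
    (h₀ : IsIso (S.map' 0 1)) (h₁ : IsIso (S.map' (e + 2) (e + 2 + 1)))
    (z₀ : S.map' 1 2 = 0) (z₁ : S.map' (e + 1) (e + 2) = 0)
    (hz : ∀ (i : ℕ) (hi : i < e), Limits.IsZero (S.obj' (i + 2))) : IsDExact S where
  kernel :=
    { injective := fun T f hf => by rwa [← cancel_mono (S.map' 0 1), Limits.zero_comp]
      exact := fun i hi T f => by
        match i with
        | 0 =>
          obtain ⟨q, -, hq⟩ := h₀.out
          refine iff_of_true (by rw [z₀, Limits.comp_zero]) ⟨f ≫ q, ?_⟩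
          rw [Category.assoc, hq, Category.comp_id]
        | i + 1 =>
          rcases Nat.lt_or_ge i e with h | h
          · exact iff_of_true ((hz i h).eq_of_tgt f 0 ▸ Limits.zero_comp)
              ⟨0, (hz i h).eq_of_tgt _ _⟩
          · obtain rfl : i = e := by omega
            refine ⟨fun h => ⟨0, ?_⟩, ?_⟩
            · rw [Limits.zero_comp, ← cancel_mono (S.map' (i + 2) (i + 2 + 1)), h,
                Limits.zero_comp]
            · rintro ⟨g, rfl⟩
              rw [z₁, Limits.comp_zero, Limits.zero_comp] }
  cokernel :=
    { injective := fun T f hf => by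
        rwa [← cancel_epi (S.map' (e + 2) (e + 2 + 1)), Limits.comp_zero]
      exact := fun i hi T f => by
        match i with
        | 0 =>
          refine ⟨fun h => ⟨0, ?_⟩, ?_⟩
          · rw [Limits.comp_zero, ← cancel_epi (S.map' 0 1), h, Limits.comp_zero]
          · rintro ⟨g, rfl⟩
            rw [reassoc_of% z₀, Limits.zero_comp, Limits.comp_zero]
        | i + 1 =>
          rcases Nat.lt_or_ge i e with h | h
          · exact iff_of_true ((hz i h).eq_of_src f 0 ▸ Limits.comp_zero)
              ⟨0, (hz i h).eq_of_src _ _⟩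
          · obtain rfl : i = e := by omega
            obtain ⟨q, hq, -⟩ := h₁.out
            refine iff_of_true (by rw [z₁, Limits.zero_comp]) ⟨q ≫ f, ?_⟩
            rw [← Category.assoc, hq, Category.id_comp] }

/-- A split extension of objects of `W` is Yoneda equivalent to `A ⟶ A ⟶ 0 ⟶ ⋯ ⟶ 0 ⟶ B ⟶ B`. -/
theorem DExtension.IsSplit.exists_yonedaEquivalent [Limits.HasZeroObject M]
    {W : ObjectProperty M} (hW : IsAdditiveSubcategory W) {A B : M} (hA : W A) (hB : W B)
    {e : ℕ} {E : DExtension (e + 2) A B} (hE : E.IsSplit) :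
    ∃ E' : DExtension (e + 2) A B, E.YonedaEquivalent E' ∧ ∀ i, W (E'.seq.obj i) := by
  obtain ⟨S, ⟨iA⟩, ⟨iB⟩, h₀, h₁, z₀, z₁, hz, hSW⟩ := hW.exists_id_zero_id hA hB e
  obtain ⟨r, hr⟩ := hE
  obtain ⟨q, -, hq⟩ := h₁.out
  let E' : DExtension (e + 2) A B := ⟨S, isDExact_of_id_zero_id S h₀ h₁ z₀ z₁ hz, iA, iB⟩
  refine ⟨E', .rel _ _ ?_, hSW⟩
  let l : E.seq.obj' 0 ⟶ S.obj' 0 := E.left.hom ≫ iA.inv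
  let t : E.seq.obj' (e + 2 + 1) ⟶ S.obj' (e + 2 + 1) := E.right.hom ≫ iB.inv
  -- the morphism to the trivial extension: `r` in degree `1`, the last morphism of `E` in the last
  -- degree but one, zero strictly between
  let a : ∀ i : ℕ, ∀ hi : i < e + 2 + 1 + 1, (E.seq.obj ⟨i, hi⟩ ⟶ S.obj ⟨i, hi⟩) := fun i hi =>
    if h : i = 0 then by subst h; exact l
    else if h : i = 1 then by subst h; exact r ≫ l ≫ S.map' 0 1
    else if h : i = e + 2 then by
      subst h; exact E.seq.map' (e + 2) (e + 2 + 1) ≫ t ≫ q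
    else if h : i = e + 2 + 1 then by subst h; exact t
    else 0
  have a₀ : a 0 (by omega) = l := rfl
  have a₁ : a 1 (by omega) = r ≫ l ≫ S.map' 0 1 := rfl
  have a₂ : a (e + 2) (by omega) =
      E.seq.map' (e + 2) (e + 2 + 1) ≫ t ≫ q := by
    simp [a]
  have a₃ : a (e + 2 + 1) (by omega) = t := by simp [a]
  have c := E.isDExact.kernel
  refine ⟨ComposableArrows.homMk (fun i => a i.1 i.2) (fun i hi => ?_), ?_, ?_⟩
  · change E.seq.map' i (i + 1) ≫ a (i + 1) _ = a i _ ≫ S.map' i (i + 1)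
    rcases Nat.eq_zero_or_pos i with rfl | hi0
    · rw [a₀, a₁, reassoc_of% hr]
    rcases Nat.lt_or_ge (e + 1) i with h | h
    · obtain rfl : i = e + 2 := by omega
      rw [a₃, a₂, Category.assoc, Category.assoc, hq, Category.comp_id]
    have hl : S.map' i (i + 1) = 0 ∨ a i (by omega) = 0 := by
      rcases Nat.lt_or_ge 1 i with h1 | h1
      · right
        obtain ⟨j, rfl⟩ : ∃ j, i = j + 2 := ⟨i - 2, by omega⟩
        exact (hz j (by omega)).eq_of_tgt _ _
      · obtain rfl : i = 1 := by omega
        exact Or.inl z₀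
    have hr : a i (by omega) ≫ S.map' i (i + 1) = 0 := by
      rcases hl with hl | hl
      · rw [hl, Limits.comp_zero]
      · rw [hl, Limits.zero_comp]
    rw [hr]
    rcases Nat.lt_or_ge i (e + 1) with h1 | h1
    · obtain ⟨j, rfl⟩ : ∃ j, i = j + 1 := ⟨i - 1, by omega⟩
      rw [(hz j (by omega)).eq_of_tgt (a (j + 1 + 1) _) 0, Limits.comp_zero]
    · obtain rfl : i = e + 1 := by omega
      rw [a₂, reassoc_of% c.comp_eq_zero (e + 1) (by omega), Limits.zero_comp]
  · change l ≫ iA.hom = _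
    simp only [l, Category.assoc]
    exact congrArg _ iA.inv_hom_id |>.trans (Category.comp_id _)
  · change a (e + 2 + 1) _ ≫ iB.hom = _
    rw [a₃]; simp [t]

end Trivial

/-! ### Comparison of higher kernels and cokernels -/

section Comparison

variable {M : Type u} [Category.{v} M] [Preadditive M]

/-- Comparison of a `d`-cokernel sequence `T` with a `d`-kernel sequence `S`: a partial chain map is
null-homotopic as soon as all morphisms `T₀ ⟶ S₀` extend to `T₁`. -/
theorem exists_homotopy {d : ℕ} {S T : ComposableArrows M (d + 1)} (hS : IsDKernel S)
    (hT : IsDCokernel T) (h₀ : ∀ φ : T.obj' 0 ⟶ S.obj' 0, ∃ h : T.obj' 1 ⟶ S.obj' 0, T.map' 0 1 ≫ h = φ)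
    (i : ℕ) (hi : i < d) (u : T.obj' (i + 1) ⟶ S.obj' (i + 1)) (φ : T.obj' i ⟶ S.obj' i)
    (hu : T.map' i (i + 1) ≫ u = φ ≫ S.map' i (i + 1)) :
    ∃ (h : T.obj' (i + 1) ⟶ S.obj' i) (h' : T.obj' (i + 2) ⟶ S.obj' (i + 1)),
      u = h ≫ S.map' i (i + 1) + T.map' (i + 1) (i + 2) ≫ h' := by
  induction i with
  | zero =>
    obtain ⟨h, rfl⟩ := h₀ φ
    obtain ⟨h', hh'⟩ := (hT.exact 0 hi _ (u - h ≫ S.map' 0 1)).1 (by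
      rw [Preadditive.comp_sub, hu, Category.assoc, sub_self])
    exact ⟨h, h', by rw [hh']; abel⟩
  | succ i ih =>
    obtain ⟨ψ, hψ⟩ := (hS.exact i (by omega) _ (T.map' i (i + 1) ≫ φ)).1 (by
      rw [Category.assoc, ← hu, ← Category.assoc, hT.comp_eq_zero i (by omega),
        Limits.zero_comp])
    obtain ⟨h, h', hh⟩ := ih (by omega) φ ψ hψ.symm
    obtain ⟨h'', hh''⟩ := (hT.exact (i + 1) hi _ (u - h' ≫ S.map' (i + 1) (i + 2))).1 (by
      rw [Preadditive.comp_sub, hu, hh, Preadditive.add_comp, Category.assoc, Category.assoc,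
        hS.comp_eq_zero i (by omega)]
      simp)
    exact ⟨h', h'', by rw [hh'']; abel⟩

/-- In the situation of `exists_homotopy`, a morphism between the last terms which lifts one step
factors through the last morphism of `S`. -/
theorem exists_lift_of_comparison {d : ℕ} (hd : 0 < d) {S T : ComposableArrows M (d + 1)}
    (hS : IsDKernel S) (hT : IsDCokernel T)
    (h₀ : ∀ φ : T.obj' 0 ⟶ S.obj' 0, ∃ h : T.obj' 1 ⟶ S.obj' 0, T.map' 0 1 ≫ h = φ)
    (u : T.obj' (d + 1) ⟶ S.obj' (d + 1)) (φ : T.obj' d ⟶ S.obj' d)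
    (hu : T.map' d (d + 1) ≫ u = φ ≫ S.map' d (d + 1)) :
    ∃ h : T.obj' (d + 1) ⟶ S.obj' d, h ≫ S.map' d (d + 1) = u := by
  obtain ⟨i, rfl⟩ : ∃ i, d = i + 1 := ⟨d - 1, by omega⟩
  obtain ⟨ψ, hψ⟩ := (hS.exact i (by omega) _ (T.map' i (i + 1) ≫ φ)).1 (by
    rw [Category.assoc, ← hu, ← Category.assoc, hT.comp_eq_zero i (by omega), Limits.zero_comp])
  obtain ⟨h, h', hh⟩ := exists_homotopy hS hT h₀ i (by omega) φ ψ hψ.symm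
  refine ⟨h', (sub_eq_zero.1 (hT.injective _ _ ?_)).symm⟩
  rw [Preadditive.comp_sub, hu, hh, Preadditive.add_comp, Category.assoc, Category.assoc,
    hS.comp_eq_zero i (by omega)]
  simp

end Comparison

/-! ### Categories generated by a chain of objects -/

/-- The objects `f₁, …, f_N` generate the `k`-linear category `C` additively, and they form the
category of the linear quiver `1 ⟶ 2 ⟶ ⋯ ⟶ N` modulo paths of length `ℓ`: there are basis morphisms
`b : f_i ⟶ f_j` for `i ≤ j`, compatible with composition, which are zero exactly when
`i + ℓ ≤ j`. -/
structure NakayamaFamily (k : Type u) [Field k] {C : Type v} [Category.{w} C] [Preadditive C]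
    [Linear k C] (N ℓ : ℕ) (f : {i : ℕ // i ∈ Finset.Icc 1 N} → C) where
  b : ∀ {i j : {i : ℕ // i ∈ Finset.Icc 1 N}}, i ≤ j → (f i ⟶ f j)
  b_refl : ∀ i, b (le_refl i) = 𝟙 (f i)
  b_comp : ∀ {i j t} (h : i ≤ j) (h' : j ≤ t), b h ≫ b h' = b (h.trans h')
  b_eq_zero_iff : ∀ {i j} (h : i ≤ j), b h = 0 ↔ i.1 + ℓ ≤ j.1
  hom_eq_smul : ∀ {i j} (h : i ≤ j) (g : f i ⟶ f j), ∃ c : k, g = c • b h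
  hom_eq_zero : ∀ {i j}, j < i → ∀ g : f i ⟶ f j, g = 0
  exists_sum : ∀ X : C, ∃ (ι : Type) (_ : Fintype ι) (t : ι → {i : ℕ // i ∈ Finset.Icc 1 N})
    (ρ : ∀ a, X ⟶ f (t a)) (σ : ∀ a, f (t a) ⟶ X), ∑ a, ρ a ≫ σ a = 𝟙 X

namespace NakayamaFamily

variable {k : Type u} [Field k] {C : Type v} [Category.{w} C] [Preadditive C] [Linear k C]
  {N ℓ : ℕ} {f : {i : ℕ // i ∈ Finset.Icc 1 N} → C} (F : NakayamaFamily k N ℓ f)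
  {W : ObjectProperty C}

include F

/-- Exactness of covariant Hom sequences may be tested on the objects `f_t`. -/
theorem exists_comp_eq_of_forall {X Y Z : C} (p : X ⟶ Y) (q : Y ⟶ Z)
    (H : ∀ t (g : f t ⟶ Y), g ≫ q = 0 → ∃ h, h ≫ p = g) {T : C} (g : T ⟶ Y) (hg : g ≫ q = 0) :
    ∃ h, h ≫ p = g := by
  obtain ⟨ι, _, t, ρ, σ, hs⟩ := F.exists_sum T
  choose h hh using fun a => H (t a) (σ a ≫ g) (by rw [Category.assoc, hg, Limits.comp_zero])
  refine ⟨∑ a, ρ a ≫ h a, ?_⟩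
  simp only [Preadditive.sum_comp, Category.assoc, hh]
  simp only [← Category.assoc, ← Preadditive.sum_comp, hs, Category.id_comp]

/-- Exactness of contravariant Hom sequences may be tested on the objects `f_t`. -/
theorem exists_eq_comp_of_forall {X Y Z : C} (p : X ⟶ Y) (q : Y ⟶ Z)
    (H : ∀ t (g : Y ⟶ f t), p ≫ g = 0 → ∃ h, q ≫ h = g) {T : C} (g : Y ⟶ T) (hg : p ≫ g = 0) :
    ∃ h, q ≫ h = g := by
  obtain ⟨ι, _, t, ρ, σ, hs⟩ := F.exists_sum T
  choose h hh using fun a => H (t a) (g ≫ ρ a) (by rw [← Category.assoc, hg, Limits.zero_comp])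
  refine ⟨∑ a, h a ≫ σ a, ?_⟩
  simp only [Preadditive.comp_sum, ← Category.assoc, hh]
  simp only [Category.assoc, ← Preadditive.comp_sum, hs, Category.comp_id]

theorem eq_zero_of_forall_comp {X Y : C} (g : X ⟶ Y)
    (H : ∀ t (h : f t ⟶ X), h ≫ g = 0) : g = 0 := by
  obtain ⟨ι, _, t, ρ, σ, hs⟩ := F.exists_sum X
  rw [← Category.id_comp g, ← hs, Preadditive.sum_comp]
  exact Finset.sum_eq_zero fun a _ => by rw [Category.assoc, H, Limits.comp_zero]

theorem eq_zero_of_forall_comp' {X Y : C} (g : X ⟶ Y)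
    (H : ∀ t (h : Y ⟶ f t), g ≫ h = 0) : g = 0 := by
  obtain ⟨ι, _, t, ρ, σ, hs⟩ := F.exists_sum Y
  rw [← Category.comp_id g, ← hs, Preadditive.comp_sum]
  exact Finset.sum_eq_zero fun a _ => by rw [← Category.assoc, H, Limits.zero_comp]

variable {x y z : {i : ℕ // i ∈ Finset.Icc 1 N}}

/-- The sequence `f_x ⟶ f_y ⟶ f_z` with `z = x + ℓ` is exact for `Hom (T, -)`. -/
theorem exact_covariant (hxy : x ≤ y) (hyz : y ≤ z) (hxz : z.1 = x.1 + ℓ) {T : C}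
    (g : T ⟶ f y) : g ≫ F.b hyz = 0 ↔ ∃ h, h ≫ F.b hxy = g := by
  constructor
  · refine fun hg => F.exists_comp_eq_of_forall _ (F.b hyz) (fun t g hg => ?_) g hg
    rcases lt_or_ge y t with h | h
    · exact ⟨0, by rw [F.hom_eq_zero h g, Limits.zero_comp]⟩
    obtain ⟨c, rfl⟩ := F.hom_eq_smul h g
    rw [Linear.smul_comp, F.b_comp, smul_eq_zero, F.b_eq_zero_iff] at hg
    rcases hg with rfl | hg
    · exact ⟨0, by simp⟩
    · have hxt : t ≤ x := Subtype.coe_le_coe.1 (by omega)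
      exact ⟨c • F.b hxt, by rw [Linear.smul_comp, F.b_comp]⟩
  · rintro ⟨h, rfl⟩
    rw [Category.assoc, F.b_comp, (F.b_eq_zero_iff _).2 hxz.ge, Limits.comp_zero]

/-- The sequence `f_x ⟶ f_y ⟶ f_z` with `z = x + ℓ` is exact for `Hom (-, T)`. -/
theorem exact_contravariant (hxy : x ≤ y) (hyz : y ≤ z) (hxz : z.1 = x.1 + ℓ) {T : C}
    (g : f y ⟶ T) : F.b hxy ≫ g = 0 ↔ ∃ h, F.b hyz ≫ h = g := by
  constructor
  · refine fun hg => F.exists_eq_comp_of_forall (F.b hxy) _ (fun t g hg => ?_) g hg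
    rcases lt_or_ge t y with h | h
    · exact ⟨0, by rw [F.hom_eq_zero h g, Limits.comp_zero]⟩
    obtain ⟨c, rfl⟩ := F.hom_eq_smul h g
    rw [Linear.comp_smul, F.b_comp, smul_eq_zero, F.b_eq_zero_iff] at hg
    rcases hg with rfl | hg
    · exact ⟨0, by simp⟩
    · have hxt : z ≤ t := Subtype.coe_le_coe.1 (by omega)
      exact ⟨c • F.b hxt, by rw [Linear.comp_smul, F.b_comp]⟩
  · rintro ⟨h, rfl⟩
    rw [← Category.assoc, F.b_comp, (F.b_eq_zero_iff _).2 hxz.ge, Limits.zero_comp]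

/-- The canonical morphism to `f_y` with `y ≤ ℓ` is a monomorphism, as `y < t + ℓ` for all indices
`t`. -/
theorem eq_zero_of_comp_b (hxy : x ≤ y) (h : y.1 ≤ ℓ) {T : C} (g : T ⟶ f x)
    (hg : g ≫ F.b hxy = 0) : g = 0 := by
  refine F.eq_zero_of_forall_comp g fun t u => ?_
  rcases lt_or_ge x t with h' | h'
  · exact F.hom_eq_zero h' _
  obtain ⟨c, hc⟩ := F.hom_eq_smul h' (u ≫ g)
  have h1 : (u ≫ g) ≫ F.b hxy = 0 := by rw [Category.assoc, hg, Limits.comp_zero]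
  rw [hc, Linear.smul_comp, F.b_comp, smul_eq_zero, F.b_eq_zero_iff] at h1
  have := (Finset.mem_Icc.1 t.2).1
  rw [hc, h1.resolve_right (by omega), zero_smul]

/-- The canonical morphism from `f_x` with `N < x + ℓ` is an epimorphism. -/
theorem eq_zero_of_b_comp (hxy : x ≤ y) (h : N < x.1 + ℓ) {T : C} (g : f y ⟶ T)
    (hg : F.b hxy ≫ g = 0) : g = 0 := by
  refine F.eq_zero_of_forall_comp' g fun t u => ?_
  rcases lt_or_ge t y with h' | h'
  · exact F.hom_eq_zero h' _
  obtain ⟨c, hc⟩ := F.hom_eq_smul h' (g ≫ u)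
  have h1 : F.b hxy ≫ (g ≫ u) = 0 := by rw [← Category.assoc, hg, Limits.zero_comp]
  rw [hc, Linear.comp_smul, F.b_comp, smul_eq_zero, F.b_eq_zero_iff] at h1
  have := (Finset.mem_Icc.1 t.2).2
  rw [hc, h1.resolve_right (by omega), zero_smul]

omit F in
theorem index_mono {i r : ℕ} (hr : r ≤ ℓ) : Monotone fun a : ℕ => i + a / 2 * ℓ + a % 2 * r := by
  refine monotone_nat_of_le_succ fun a => ?_
  rcases Nat.even_or_odd' a with ⟨c, rfl | rfl⟩
  · have h1 : (2 * c + 1) / 2 = c := by omega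
    have h2 : (2 * c + 1) % 2 = 1 := by omega
    simp [h1, h2]
  · have h1 : (2 * c + 1) / 2 = c := by omega
    have h2 : (2 * c + 1) % 2 = 1 := by omega
    have h3 : (2 * c + 1 + 1) / 2 = c + 1 := by omega
    have h4 : (2 * c + 1 + 1) % 2 = 0 := by omega
    simp only [h1, h2, h3, h4]
    linarith

omit F in
theorem index_mem {i r D a : ℕ} (hN : N = D * ℓ + ℓ) (hi : 1 ≤ i) (hr : i + r ≤ ℓ)
    (ha : a < 2 * D + 1 + 1) : i + a / 2 * ℓ + a % 2 * r ∈ Finset.Icc 1 N := by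
  have h1 : a / 2 * ℓ ≤ D * ℓ := Nat.mul_le_mul_right _ (by omega)
  have h2 : a % 2 * r ≤ 1 * r := Nat.mul_le_mul_right _ (by omega)
  rw [Finset.mem_Icc]
  omega

/-- The sequence `f_i ⟶ f_{i+r} ⟶ f_{i+ℓ} ⟶ f_{i+ℓ+r} ⟶ ⋯ ⟶ f_{i+Dℓ} ⟶ f_{i+Dℓ+r}`. -/
def staircase {i r D : ℕ} (hN : N = D * ℓ + ℓ) (hi : 1 ≤ i) (hr : i + r ≤ ℓ) :
    ComposableArrows C (2 * D + 1) where
  obj a := f ⟨_, index_mem hN hi hr a.2⟩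
  map {a c} h := F.b (Subtype.coe_le_coe.1 (index_mono (i := i) (by omega) (leOfHom h)))
  map_id a := F.b_refl _
  map_comp h h' := (F.b_comp _ _).symm

theorem isDExact_staircase {i r D : ℕ} (hN : N = D * ℓ + ℓ) (hi : 1 ≤ i) (hr : i + r ≤ ℓ) :
    IsDExact (F.staircase hN hi hr) := by
  have hs : ∀ a : ℕ, i + (a + 2) / 2 * ℓ + (a + 2) % 2 * r = i + a / 2 * ℓ + a % 2 * r + ℓ := by
    intro a
    rw [Nat.add_div_right a two_pos, Nat.add_mod_right, Nat.succ_mul]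
    ring
  refine ⟨⟨fun T g hg => ?_, fun a ha T g => ?_⟩, ⟨fun T g hg => ?_, fun a ha T g => ?_⟩⟩
  · exact F.eq_zero_of_comp_b _ (by simpa using hr) g hg
  · exact F.exact_covariant _ _ (hs a) g
  · refine F.eq_zero_of_b_comp _ ?_ g hg
    have h1 : 2 * D / 2 = D := by omega
    have h2 : 2 * D % 2 = 0 := by omega
    simp only [h1, h2]
    omega
  · exact F.exact_contravariant _ _ (hs a) g

/-- In a wide subcategory in which all morphisms are regular, the indices of the objects `f_i` have
distance at least `ℓ` since `f_i ⟶ f_j` is not regular for `i < j < i + ℓ`, and at most `Dℓ` since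
otherwise `staircase` is a nonsplit extension of `f_j` by `f_i`. -/
theorem bounds_of_isWide {D : ℕ} (hℓ : 0 < ℓ) (hN : N = D * ℓ + ℓ)
    (reg : ∀ {X Y : C}, W X → W Y → ∀ g : X ⟶ Y, ∃ h : Y ⟶ X, g ≫ h ≫ g = g)
    (hW : IsWide (2 * D) W) {i j : {i : ℕ // i ∈ Finset.Icc 1 N}} (hij : i < j)
    (hi : W (f i)) (hj : W (f j)) : i.1 + ℓ ≤ j.1 ∧ j.1 ≤ i.1 + D * ℓ := by
  have hi1 := Finset.mem_Icc.1 i.2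
  have hj1 := Finset.mem_Icc.1 j.2
  refine ⟨?_, ?_⟩
  · obtain ⟨h, hh⟩ := reg hi hj (F.b hij.le)
    rw [F.hom_eq_zero hij h, Limits.zero_comp, Limits.comp_zero] at hh
    exact (F.b_eq_zero_iff _).1 hh.symm
  · by_contra! hlt
    obtain ⟨r, hr⟩ : ∃ r, j.1 = i.1 + D * ℓ + r := ⟨j.1 - (i.1 + D * ℓ), by omega⟩
    have hir : i.1 + r ≤ ℓ := by omega
    let E : DExtension (2 * D) (f i) (f j) :=
      { seq := F.staircase hN hi1.1 hir
        isDExact := F.isDExact_staircase hN hi1.1 hir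
        left := eqToIso (congrArg f (Subtype.ext (by simp)))
        right := eqToIso (congrArg f (Subtype.ext (by
          have h1 : (2 * D + 1) / 2 = D := by omega
          have h2 : (2 * D + 1) % 2 = 1 := by omega
          simp only [h1, h2]
          omega))) }
    obtain ⟨E', hE', hEW⟩ := hW.extension E hi hj
    have hs : E'.IsSplit := by
      -- the first morphism of `E'` is a regular monomorphism
      obtain ⟨h, hh⟩ := reg (hEW ⟨0, by omega⟩) (hEW ⟨1, by omega⟩) (E'.seq.map' 0 1)
      refine ⟨h, sub_eq_zero.1 (E'.isDExact.kernel.injective _ _ ?_)⟩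
      rw [Preadditive.sub_comp, Category.assoc, hh, Category.id_comp, sub_self]
    obtain ⟨s, hs⟩ := hE'.isSplit_iff.2 hs
    have hs0 : s = 0 := F.hom_eq_zero (Subtype.coe_lt_coe.1 (by simp; omega)) s
    rw [hs0, Limits.comp_zero] at hs
    have h2 := (F.b_eq_zero_iff (le_refl _)).1 ((F.b_refl _).trans hs.symm)
    omega

/-- An object of `W` is a direct summand of a finite direct sum of objects `f_t` lying in `W`: for
the other `t`, all composites `f_t ⟶ X ⟶ f_t` vanish, and as morphisms between the `f_t` only go up,
the corresponding part of the identity of `X` is nilpotent. -/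
theorem exists_sum_mem [IsIdempotentComplete C] (hW : IsAdditiveSubcategory W) {X : C}
    (hX : W X) :
    ∃ (ι : Type) (_ : Fintype ι) (t : ι → {i : ℕ // i ∈ Finset.Icc 1 N})
      (ρ : ∀ a, X ⟶ f (t a)) (σ : ∀ a, f (t a) ⟶ X),
      (∀ a, W (f (t a))) ∧ ∑ a, ρ a ≫ σ a = 𝟙 X := by
  let P : ∀ {Y : C}, (Y ⟶ X) → Prop := fun {Y} g =>
    ∃ (ι : Type) (_ : Fintype ι) (t : ι → {i : ℕ // i ∈ Finset.Icc 1 N})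
      (ρ : ∀ a, Y ⟶ f (t a)) (σ : ∀ a, f (t a) ⟶ X),
      (∀ a, W (f (t a))) ∧ ∑ a, ρ a ≫ σ a = g
  have P0 : ∀ {Y : C}, P (0 : Y ⟶ X) := fun {Y} =>
    ⟨Empty, inferInstance, Empty.elim, fun a => a.elim, fun a => a.elim, fun a => a.elim, by simp⟩
  have Padd : ∀ {Y : C} (g h : Y ⟶ X), P g → P h → P (g + h) := by
    rintro Y _ _ ⟨ι, _, t, ρ, σ, hw, rfl⟩ ⟨ι', _, t', ρ', σ', hw', rfl⟩
    exact ⟨ι ⊕ ι', inferInstance, Sum.elim t t', fun a => Sum.casesOn a ρ ρ',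
      fun a => Sum.casesOn a σ σ', fun a => Sum.casesOn a hw hw', by simp⟩
  have Pcomp : ∀ {Y Z : C} (g : Z ⟶ Y) (h : Y ⟶ X), P h → P (g ≫ h) := by
    rintro Y Z g _ ⟨ι, _, t, ρ, σ, hw, rfl⟩
    exact ⟨ι, inferInstance, t, fun a => g ≫ ρ a, σ, hw, by simp [Preadditive.comp_sum]⟩
  obtain ⟨ι, _, t, ρ, σ, hs⟩ := F.exists_sum X
  have Psum : ∀ {Y : C} (g : Y ⟶ X), (∀ a, P ((g ≫ ρ a) ≫ σ a)) → P g := by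
    intro Y g hg
    rw [← Category.comp_id g, ← hs, Preadditive.comp_sum]
    simp only [← Category.assoc]
    exact Finset.sum_induction _ P Padd P0 fun a _ => hg a
  -- descending induction on the index `i`
  have key : ∀ (n : ℕ) (i) (_ : N < i.1 + n) (g : f i ⟶ X), P g := by
    intro n
    induction n with
    | zero => intro i hi; have := Finset.mem_Icc.1 i.2; omega
    | succ n ih =>
      intro i hi g
      by_cases hWi : W (f i)
      · exact ⟨Unit, inferInstance, fun _ => i, fun _ => 𝟙 _, fun _ => g, fun _ => hWi, by simp⟩
      refine Psum g fun a => ?_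
      rcases lt_trichotomy (t a) i with h | h | h
      · rw [F.hom_eq_zero h (g ≫ ρ a), Limits.zero_comp]; exact P0
      · suffices h0 : g ≫ ρ a = 0 by rw [h0, Limits.zero_comp]; exact P0
        obtain ⟨c, hc⟩ := F.hom_eq_smul h.ge (g ≫ ρ a)
        by_contra hne
        have hc0 : c ≠ 0 := fun h0 => hne (by rw [hc, h0, zero_smul])
        refine hWi (hW.of_retract g (c⁻¹ • ρ a ≫ F.b h.le) ?_ hX)
        rw [Linear.comp_smul, ← Category.assoc, hc, Linear.smul_comp, F.b_comp, smul_smul,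
          inv_mul_cancel₀ hc0, one_smul, F.b_refl]
      · exact Pcomp _ _ (ih _ (by have := Subtype.coe_lt_coe.2 h; omega) _)
  exact Psum (𝟙 X) fun a => Pcomp _ _ (key N _ (by have := Finset.mem_Icc.1 (t a).2; omega) _)

/-- If there are no nonzero morphisms between different `f_i` in `W`, then
`End X ≅ ∏ᵢ End_k (Hom (f_i, X))` for `X` in `W`. -/
theorem isSemisimpleCategory [IsIdempotentComplete C] (hW : IsAdditiveSubcategory W)
    (h : ∀ i j, i < j → W (f i) → W (f j) → i.1 + ℓ ≤ j.1) :
    IsSemisimpleCategory W.FullSubcategory := by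
  intro X
  obtain ⟨ι, _, t, ρ, σ, hw, hs⟩ := F.exists_sum_mem hW X.property
  have hzero : ∀ {i j}, i ≠ j → W (f i) → W (f j) → ∀ g : f i ⟶ f j, g = 0 := by
    intro i j hij hi hj g
    rcases lt_or_gt_of_ne hij with hlt | hgt
    · obtain ⟨c, rfl⟩ := F.hom_eq_smul hlt.le g
      rw [(F.b_eq_zero_iff _).2 (h i j hlt hi hj), smul_zero]
    · exact F.hom_eq_zero hgt g
  have hexp : ∀ {Y : C} (u : Y ⟶ X.obj), u = ∑ a, (u ≫ ρ a) ≫ σ a := by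
    intro Y u
    simp only [Category.assoc, ← Preadditive.comp_sum, hs, Category.comp_id]
  let J := {i // W (f i)}
  let Φ : End X →+* ∀ i : J, Module.End k (f i.1 ⟶ X.obj) :=
    { toFun := fun φ i => Linear.rightComp k (f i.1) φ.hom
      map_one' := by ext i u; exact Category.comp_id u
      map_mul' := fun φ ψ => by ext i u; exact (Category.assoc _ _ _).symm
      map_zero' := by ext i u; exact Limits.comp_zero
      map_add' := fun φ ψ => by ext i u; exact Preadditive.comp_add _ _ _ _ _ _ }
  have hfin : ∀ i : J, Module.Finite k (f i.1 ⟶ X.obj) := by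
    intro i
    -- the composites of the basis morphisms `f_i ⟶ f_{t a}` with the `σ a` span `Hom (f_i, X)`
    have : ∀ a, ∃ v : f i.1 ⟶ X.obj, ∀ g : f i.1 ⟶ f (t a), ∃ c : k, c • v = g ≫ σ a := by
      intro a
      rcases lt_or_ge (t a) i.1 with hlt | hle
      · exact ⟨0, fun g => ⟨0, by rw [F.hom_eq_zero hlt g]; simp⟩⟩
      · refine ⟨F.b hle ≫ σ a, fun g => ?_⟩
        obtain ⟨c, rfl⟩ := F.hom_eq_smul hle g
        exact ⟨c, by simp⟩
    choose v hv using this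
    refine ⟨(Submodule.fg_def (R := k)).2 ⟨Set.range v, Set.finite_range v, ?_⟩⟩
    rw [eq_top_iff]
    rintro u -
    rw [hexp u]
    refine Submodule.sum_mem _ fun a _ => ?_
    obtain ⟨c, hc⟩ := hv a (u ≫ ρ a)
    rw [← hc]
    exact Submodule.smul_mem _ _ (Submodule.subset_span ⟨a, rfl⟩)
  have hinj : Function.Injective Φ := by
    rw [injective_iff_map_eq_zero]
    intro φ hφ
    have h0 : ∀ i : J, ∀ u : f i.1 ⟶ X.obj, u ≫ φ.hom = 0 := fun i u =>
      LinearMap.congr_fun (congrFun hφ i) u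
    refine ObjectProperty.hom_ext _ ?_
    change φ.hom = 0
    rw [← Category.id_comp φ.hom, ← hs, Preadditive.sum_comp]
    exact Finset.sum_eq_zero fun a _ => by
      rw [Category.assoc, h0 ⟨t a, hw a⟩, Limits.comp_zero]
  have hsurj : Function.Surjective Φ := by
    intro L
    refine ⟨ObjectProperty.homMk (∑ a, ρ a ≫ L ⟨t a, hw a⟩ (σ a)), ?_⟩
    ext i u
    change u ≫ ∑ a, ρ a ≫ L ⟨t a, hw a⟩ (σ a) = L i u
    conv_rhs => rw [hexp u]
    rw [Preadditive.comp_sum, map_sum]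
    refine Finset.sum_congr rfl fun a _ => ?_
    rw [← Category.assoc]
    by_cases hia : i.1 = t a
    · obtain rfl : i = ⟨t a, hw a⟩ := Subtype.ext hia
      obtain ⟨c, hc⟩ := F.hom_eq_smul (le_refl (t a)) (u ≫ ρ a)
      rw [hc, F.b_refl, Linear.smul_comp, Linear.smul_comp, Category.id_comp, Category.id_comp,
        map_smul]
    · rw [hzero hia i.2 (hw a) (u ≫ ρ a), Limits.zero_comp, Limits.zero_comp, map_zero]
  have : ∀ i : J, IsSemisimpleRing (Module.End k (f i.1 ⟶ X.obj)) := fun i =>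
    IsSemisimpleRing.moduleEnd ..
  exact (RingEquiv.ofBijective Φ ⟨hinj, hsurj⟩).symm.isSemisimpleRing

/-- For `j + ℓ ≤ N + 1` the functor `Hom (f_j, -)` is dual to `Hom (-, f_{j+ℓ-1})` through
composition, hence it maps epimorphisms to surjections. -/
theorem exists_lift_of_epi {j : {i : ℕ // i ∈ Finset.Icc 1 N}} (hℓ : 0 < ℓ)
    (hj : j.1 + ℓ ≤ N + 1) {X Y : C} (p : X ⟶ Y) (hp : ∀ (T : C) (q : Y ⟶ T), p ≫ q = 0 → q = 0)
    (u : f j ⟶ Y) : ∃ h, h ≫ p = u := by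
  by_contra hu
  obtain ⟨lam, hlu, hlp⟩ := Submodule.exists_le_ker_of_notMem
    (p := LinearMap.range (Linear.rightComp k (f j) p)) (v := u)
    (fun ⟨h, hh⟩ => hu ⟨h, hh⟩)
  have hj1 := Finset.mem_Icc.1 j.2
  let j' : {i : ℕ // i ∈ Finset.Icc 1 N} := ⟨j.1 + ℓ - 1, Finset.mem_Icc.2 (by omega)⟩
  have hjj' : j ≤ j' := Subtype.coe_le_coe.1 (by change j.1 ≤ j.1 + ℓ - 1; omega)
  have hb : F.b hjj' ≠ 0 := fun h => by
    have : j.1 + ℓ ≤ j.1 + ℓ - 1 := (F.b_eq_zero_iff _).1 h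
    omega
  -- the linear form `lam` is represented by a morphism `Y ⟶ f_{j+ℓ-1}`
  have hrep : ∃ y : Y ⟶ f j', ∀ x : f j ⟶ Y, x ≫ y = lam x • F.b hjj' := by
    obtain ⟨ι, _, t, ρ, σ, hs⟩ := F.exists_sum Y
    have : ∀ a, ∃ y : f (t a) ⟶ f j', ∀ x : f j ⟶ f (t a),
        x ≫ y = lam (x ≫ σ a) • F.b hjj' := by
      intro a
      rcases lt_or_ge (t a) j with h1 | h1
      · exact ⟨0, fun x => by rw [F.hom_eq_zero h1 x]; simp⟩
      rcases lt_or_ge j' (t a) with h2 | h2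
      · refine ⟨0, fun x => ?_⟩
        obtain ⟨c, rfl⟩ := F.hom_eq_smul h1 x
        have h3 : j.1 + ℓ ≤ (t a).1 := by
          have : j.1 + ℓ - 1 < (t a).1 := Subtype.coe_lt_coe.2 h2
          omega
        rw [(F.b_eq_zero_iff _).2 h3]; simp
      · refine ⟨lam (F.b h1 ≫ σ a) • F.b h2, fun x => ?_⟩
        obtain ⟨c, rfl⟩ := F.hom_eq_smul h1 x
        rw [Linear.comp_smul, Linear.smul_comp, F.b_comp, Linear.smul_comp, map_smul, smul_smul,
          smul_eq_mul, mul_comm]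
    choose y hy using this
    refine ⟨∑ a, ρ a ≫ y a, fun x => ?_⟩
    rw [Preadditive.comp_sum]
    simp only [← Category.assoc, hy]
    rw [← Finset.sum_smul, ← map_sum]
    simp only [Category.assoc, ← Preadditive.comp_sum, hs, Category.comp_id]
  obtain ⟨y, hy⟩ := hrep
  have hpy : p ≫ y = 0 := by
    -- the pairing `Hom (f_j, X) × Hom (X, f_{j+ℓ-1}) → k` is nondegenerate
    refine F.eq_zero_of_forall_comp _ fun t h => ?_
    rcases lt_or_ge j' t with h2 | h2
    · exact F.hom_eq_zero h2 _
    obtain ⟨c, hc⟩ := F.hom_eq_smul h2 (h ≫ p ≫ y)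
    rcases lt_or_ge t j with h1 | h1
    · rw [hc, (F.b_eq_zero_iff _).2, smul_zero]
      have : t.1 < j.1 := Subtype.coe_lt_coe.2 h1
      change t.1 + ℓ ≤ j.1 + ℓ - 1
      omega
    · have h3 : F.b h1 ≫ h ≫ p ≫ y = 0 := by
        have h4 : lam (F.b h1 ≫ h ≫ p) = 0 :=
          hlp ⟨F.b h1 ≫ h, by simp⟩
        have h5 := hy (F.b h1 ≫ h ≫ p)
        rw [h4, zero_smul] at h5
        simpa using h5
      rw [hc, Linear.comp_smul, F.b_comp] at h3
      rw [hc, (smul_eq_zero.1 h3).resolve_right hb, zero_smul]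
  have h1 := hy u
  rw [hp _ y hpy, Limits.comp_zero] at h1
  exact (smul_ne_zero hlu hb) h1.symm

/-- If the indices of the objects `f_i` in `W` have distance at most `Dℓ`, then all `2D`-extensions
of objects of `W` split. -/
theorem isSplit [IsIdempotentComplete C] {D : ℕ} (hℓ : 0 < ℓ) (hD : 0 < D)
    (hN : N = D * ℓ + ℓ) (hW : IsAdditiveSubcategory W)
    (h : ∀ i j, i < j → W (f i) → W (f j) → j.1 ≤ i.1 + D * ℓ) {A B : C}
    (E : DExtension (2 * D) A B) (hA : W A) (hB : W B) : E.IsSplit := by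
  have hA' : W (E.seq.obj' 0) := hW.iso E.left.symm hA
  have hB' : W (E.seq.obj' (2 * D + 1)) := hW.iso E.right.symm hB
  have hlow : ∀ (j : {i : ℕ // i ∈ Finset.Icc 1 N}) (_ : j.1 ≤ D * ℓ + 1)
      (u : f j ⟶ E.seq.obj' (2 * D + 1)), ∃ q, q ≫ E.seq.map' (2 * D) (2 * D + 1) = u :=
    fun j hj u => F.exists_lift_of_epi hℓ (by omega) _ E.isDExact.cokernel.injective u
  have hlift : ∀ (j : {i : ℕ // i ∈ Finset.Icc 1 N}) (_ : W (f j))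
      (u : f j ⟶ E.seq.obj' (2 * D + 1)), ∃ q, q ≫ E.seq.map' (2 * D) (2 * D + 1) = u := by
    intro j hj u
    rcases Nat.lt_or_ge (D * ℓ + 1) j.1 with hlt | hle
    swap
    · exact hlow j hle u
    -- compare with the staircase from `f_1` to `f_j`
    have hj1 := Finset.mem_Icc.1 j.2
    obtain ⟨s, hs⟩ : ∃ s, j.1 = 1 + D * ℓ + s := ⟨j.1 - (1 + D * ℓ), by omega⟩
    have hsl : 1 + s ≤ ℓ := by omega
    have h1 : (2 * D + 1) / 2 = D := by omega
    have h2 : (2 * D + 1) % 2 = 1 := by omega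
    have h3 : 2 * D / 2 = D := by omega
    have h4 : 2 * D % 2 = 0 := by omega
    let T := F.staircase hN le_rfl hsl
    have hjT : (⟨_, index_mem hN le_rfl hsl (Nat.lt_succ_self _)⟩ :
        {i : ℕ // i ∈ Finset.Icc 1 N}) = j := Subtype.ext (by simp only [h1, h2]; omega)
    let e : T.obj' (2 * D + 1) ≅ f j := eqToIso (congrArg f hjT)
    obtain ⟨φ, hφ⟩ := hlow ⟨_, index_mem hN le_rfl hsl (a := 2 * D) (by omega)⟩
      (by simp only [h3, h4]; omega) (T.map' (2 * D) (2 * D + 1) ≫ e.hom ≫ u)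
    have hext : ∀ ψ : T.obj' 0 ⟶ E.seq.obj' 0,
        ∃ q : T.obj' 1 ⟶ E.seq.obj' 0, T.map' 0 1 ≫ q = ψ := by
      intro ψ
      -- all morphisms from `f_1` to an object of `W` factor through `f_{1+s}`
      obtain ⟨ι, _, t, ρ, σ, hw, hsum⟩ := F.exists_sum_mem hW hA'
      have hfac : ∀ a, ∃ g : T.obj' 1 ⟶ f (t a), T.map' 0 1 ≫ g = ψ ≫ ρ a := by
        intro a
        have hta : 1 + s ≤ (t a).1 := by
          rcases lt_trichotomy (t a) j with hlt | heq | hgt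
          · have := h _ _ hlt (hw a) hj
            omega
          · rw [heq]; omega
          · have := Subtype.coe_lt_coe.2 hgt
            omega
        have hle : (⟨_, index_mem hN le_rfl hsl (a := 1) (by omega)⟩ :
            {i : ℕ // i ∈ Finset.Icc 1 N}) ≤ t a :=
          Subtype.coe_le_coe.1 (by simpa using hta)
        have hle0 : (⟨_, index_mem hN le_rfl hsl (a := 0) (by omega)⟩ :
            {i : ℕ // i ∈ Finset.Icc 1 N}) ≤ t a :=
          Subtype.coe_le_coe.1 (by simpa using (by omega : 1 ≤ (t a).1))
        obtain ⟨c, hc⟩ := F.hom_eq_smul hle0 (ψ ≫ ρ a)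
        exact ⟨c • F.b hle, ((Linear.comp_smul _ _ _ _ _ _).trans
          (congrArg (c • ·) (F.b_comp _ hle))).trans hc.symm⟩
      choose g hg using hfac
      refine ⟨∑ a, g a ≫ σ a, ?_⟩
      rw [Preadditive.comp_sum]
      simp only [← Category.assoc, hg]
      simp only [Category.assoc, ← Preadditive.comp_sum, hsum, Category.comp_id]
    obtain ⟨q, hq⟩ := exists_lift_of_comparison (by omega) E.isDExact.kernel
      (F.isDExact_staircase hN le_rfl hsl).cokernel hext (e.hom ≫ u) φ hφ.symm
    exact ⟨e.inv ≫ q, by rw [Category.assoc, hq, e.inv_hom_id_assoc]⟩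
  obtain ⟨ι, _, t, ρ, σ, hw, hsum⟩ := F.exists_sum_mem hW hB'
  choose q hq using fun a => hlift (t a) (hw a) (σ a)
  refine E.isSplit_iff.2 ⟨∑ a, ρ a ≫ q a, ?_⟩
  rw [Preadditive.sum_comp]
  simp only [Category.assoc, hq, hsum]

/-- The characterisation of semisimple wide subcategories of a category generated by a chain. -/
theorem semisimple_and_isWide_iff [IsIdempotentComplete C] [Limits.HasZeroObject C]
    [Limits.HasBinaryBiproducts C] {D : ℕ} (hℓ : 0 < ℓ) (hD : 0 < D)
    (hN : N = D * ℓ + ℓ) (hW : IsAdditiveSubcategory W) :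
    (IsSemisimpleCategory W.FullSubcategory ∧ IsWide (2 * D) W) ↔
      ∀ i j, i < j → W (f i) → W (f j) → i.1 + ℓ ≤ j.1 ∧ j.1 ≤ i.1 + D * ℓ := by
  constructor
  · rintro ⟨hs, hwide⟩ i j hij hi hj
    exact F.bounds_of_isWide hℓ hN (fun hX hY => hW.exists_comp_comp_eq hs hX hY) hwide hij hi hj
  · intro h
    have hs := F.isSemisimpleCategory hW fun i j hij hi hj => (h i j hij hi hj).1
    obtain ⟨e, rfl⟩ : ∃ e, D = e + 1 := ⟨D - 1, by omega⟩
    refine ⟨hs, hW, fun g hX hY => ?_, fun g hX hY => ?_, fun E hA hB => ?_⟩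
    · exact hW.exists_isDKernel hX hY g (hW.exists_comp_comp_eq hs hX hY g) (2 * e + 1)
    · exact hW.exists_isDCokernel hX hY g (hW.exists_comp_comp_eq hs hX hY g) (2 * e)
    · exact DExtension.IsSplit.exists_yonedaEquivalent (e := 2 * e) hW hA hB
        (F.isSplit hℓ hD hN hW (fun i j hij hi hj => (h i j hij hi hj).2) E hA hB)

end NakayamaFamily

/-! ### The algebra `Φ` as an algebra of truncated triangular matrices -/

section Paths

variable {m : ℕ}

theorem LinearQuiver.add_length {a b : LinearQuiver m} (p : Quiver.Path a b) :
    b.1 + p.length = a.1 := by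
  induction p with
  | nil => rfl
  | cons p e ih => rw [Quiver.Path.length_cons, ← ih, e.down]; ring

theorem LinearQuiver.le_of_path {a b : LinearQuiver m} (p : Quiver.Path a b) : b.1 ≤ a.1 :=
  LinearQuiver.add_length p ▸ Nat.le_add_right _ _

instance (a b : LinearQuiver m) : Subsingleton (a ⟶ b) :=
  inferInstanceAs (Subsingleton (PLift (a.1 = b.1 + 1)))

instance (a b : LinearQuiver m) : Subsingleton (Quiver.Path a b) := by
  refine ⟨fun p => ?_⟩
  induction p with
  | nil =>
    intro q
    cases q with
    | nil => rfl
    | cons q e =>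
      have h1 := LinearQuiver.le_of_path q
      have h2 := e.down
      omega
  | cons p e ih =>
    intro q
    cases q with
    | nil =>
      have h1 := LinearQuiver.le_of_path p
      have h2 := e.down
      omega
    | cons q e' =>
      obtain rfl := Subtype.ext (e.down.trans e'.down.symm)
      rw [ih q, Subsingleton.elim e e']

theorem LinearQuiver.nonempty_path {a b : LinearQuiver m} (h : b.1 ≤ a.1) :
    Nonempty (Quiver.Path a b) := by
  obtain ⟨n, hn⟩ := Nat.exists_eq_add_of_le h
  induction n generalizing b with
  | zero => obtain rfl : a = b := Subtype.ext hn; exact ⟨.nil⟩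
  | succ n ih =>
    have ha := Finset.mem_Icc.1 a.2
    let c : LinearQuiver m := ⟨b.1 + 1, Finset.mem_Icc.2 (by omega)⟩
    obtain ⟨p⟩ := ih (b := c) (by change b.1 + 1 ≤ a.1; omega)
      (by change a.1 = b.1 + 1 + n; omega)
    exact ⟨p.cons ⟨rfl⟩⟩

end Paths

noncomputable section

namespace PathAlgebra

variable {k : Type u} [Field k] {m : ℕ}

/-- The sum of the coefficients of a linear combination of paths. -/
def coeffSum (k : Type u) [Field k] {m : ℕ} (a b : LinearQuiver m) :
    (Quiver.Path a b →₀ k) →ₗ[k] k :=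
  Finsupp.linearCombination k fun _ => 1

@[simp] theorem coeffSum_single {a b : LinearQuiver m} (p : Quiver.Path a b) (r : k) :
    coeffSum k a b (Finsupp.single p r) = r := by
  simp [coeffSum]

theorem coeffSum_concat {a b c : LinearQuiver m} (x : Quiver.Path a b →₀ k)
    (y : Quiver.Path b c →₀ k) :
    coeffSum k a c (concat k a b c x y) = coeffSum k a b x * coeffSum k b c y := by
  induction x using Finsupp.induction_linear with
  | zero => simp
  | add x x' hx hx' => simp [hx, hx', add_mul]
  | single p r =>
    induction y using Finsupp.induction_linear with
    | zero => simp
    | add y y' hy hy' => rw [map_add, map_add, hy, hy', map_add, mul_add]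
    | single q s => rw [concat_single, coeffSum_single, coeffSum_single, coeffSum_single]

theorem coeffSum_injective (a b : LinearQuiver m) : Function.Injective (coeffSum k a b) := by
  rw [injective_iff_map_eq_zero]
  intro x hx
  ext p
  have : x = Finsupp.single p (x p) := by
    ext q
    rw [Subsingleton.elim q p, Finsupp.single_eq_same]
  rw [this, coeffSum_single] at hx
  rw [hx]; rfl

/-- An element of the path algebra of `m ⟶ ⋯ ⟶ 1` as a lower triangular matrix: there is at most one
path between any two vertices. -/
def toMatrix : PathAlgebra k (LinearQuiver m) →+*
    Matrix (LinearQuiver m) (LinearQuiver m) k where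
  toFun x := Matrix.of fun a b => coeffSum k a b (x a b)
  map_one' := by
    ext a b
    rw [Matrix.of_apply]
    by_cases h : a = b
    · subst h; rw [one_apply_self, coeffSum_single, Matrix.one_apply_eq]
    · rw [one_apply_ne h, map_zero, Matrix.one_apply_ne h]
  map_mul' x y := by
    ext a c
    simp only [Matrix.of_apply, Matrix.mul_apply, mul_apply, map_sum, coeffSum_concat]
  map_zero' := by ext a b; simp
  map_add' x y := by ext a b; simp

theorem toMatrix_apply (x : PathAlgebra k (LinearQuiver m)) (a b : LinearQuiver m) :
    toMatrix x a b = coeffSum k a b (x a b) := rfl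

theorem toMatrix_smul (c : k) (x : PathAlgebra k (LinearQuiver m)) (a b : LinearQuiver m) :
    toMatrix (c • x) a b = c * toMatrix x a b := by
  simp [toMatrix_apply]

theorem toMatrix_injective :
    Function.Injective (toMatrix : PathAlgebra k (LinearQuiver m) →+* _) := fun _ _ h =>
  PathAlgebra.ext fun a b => coeffSum_injective a b (congrFun (congrFun h a) b)

theorem toMatrix_eq_zero (x : PathAlgebra k (LinearQuiver m)) {a b : LinearQuiver m}
    (h : a.1 < b.1) : toMatrix x a b = 0 := by
  rw [toMatrix_apply]
  have : x a b = 0 := Finsupp.ext fun p =>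
    absurd (LinearQuiver.le_of_path p) (Nat.not_le.2 h)
  rw [this, map_zero]

theorem exists_toMatrix_eq (A : Matrix (LinearQuiver m) (LinearQuiver m) k)
    (h : ∀ a b, a.1 < b.1 → A a b = 0) :
    ∃ x : PathAlgebra k (LinearQuiver m), toMatrix x = A := by
  classical
  let x : PathAlgebra k (LinearQuiver m) := fun a b =>
    if h : Nonempty (Quiver.Path a b) then Finsupp.single h.some (A a b) else 0
  refine ⟨x, ?_⟩
  ext a b
  rw [toMatrix_apply]
  change coeffSum k a b (if h : Nonempty (Quiver.Path a b) then _ else 0) = _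
  split_ifs with hp
  · exact coeffSum_single _ _
  · rw [map_zero, h a b]
    by_contra! hab
    exact hp (LinearQuiver.nonempty_path hab)

theorem toMatrix_idem (v a b : LinearQuiver m) :
    toMatrix (idem k v) a b = if a = v ∧ b = v then 1 else 0 := by
  rw [toMatrix_apply, idem]
  by_cases h : a = v ∧ v = b
  · rw [dif_pos h, coeffSum_single, if_pos ⟨h.1, h.2.symm⟩]
  · rw [dif_neg h, map_zero, if_neg fun h' => h ⟨h'.1, h'.2.symm⟩]

/-- The left ideal spanned by the paths of length at least `n`. -/
def longPaths (k : Type u) [Field k] (m n : ℕ) : Ideal (PathAlgebra k (LinearQuiver m)) where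
  carrier := {x | ∀ a b : LinearQuiver m, a.1 < b.1 + n → toMatrix x a b = 0}
  zero_mem' a b _ := by rw [map_zero]; rfl
  add_mem' hx hy a b h := by rw [map_add, Matrix.add_apply, hx a b h, hy a b h, add_zero]
  smul_mem' y x hx a b h := by
    rw [smul_eq_mul, map_mul, Matrix.mul_apply]
    refine Finset.sum_eq_zero fun c _ => ?_
    rcases Nat.lt_or_ge a.1 c.1 with hac | hac
    · rw [toMatrix_eq_zero y hac, zero_mul]
    · rw [hx c b (by omega), mul_zero]

theorem mul_mem_longPaths {n n' : ℕ} {x y : PathAlgebra k (LinearQuiver m)}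
    (hx : x ∈ longPaths k m n) (hy : y ∈ longPaths k m n') : x * y ∈ longPaths k m (n + n') := by
  intro a b h
  rw [map_mul, Matrix.mul_apply]
  refine Finset.sum_eq_zero fun c _ => ?_
  rcases Nat.lt_or_ge a.1 (c.1 + n) with hac | hac
  · rw [hx a c hac, zero_mul]
  · rw [hy c b (by omega), mul_zero]

theorem pow_mem_longPaths {x : PathAlgebra k (LinearQuiver m)} (hx : x ∈ longPaths k m 1)
    (n : ℕ) : x ^ n ∈ longPaths k m n := by
  induction n with
  | zero => exact fun a b h => toMatrix_eq_zero _ h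
  | succ n ih => rw [pow_succ]; exact mul_mem_longPaths ih hx

/-- There are no paths of length `m` on `m` vertices. -/
theorem longPaths_eq_bot : longPaths k m m = ⊥ := by
  rw [eq_bot_iff]
  intro x hx
  refine toMatrix_injective ?_
  rw [map_zero]
  ext a b
  have ha := Finset.mem_Icc.1 a.2
  have hb := Finset.mem_Icc.1 b.2
  exact hx a b (by omega)

/-- The radical is spanned by the paths of positive length: these span a nil ideal, and the
diagonal entries of matrices define ring homomorphisms to `k`. -/
theorem jacobson_eq : Ring.jacobson (PathAlgebra k (LinearQuiver m)) = longPaths k m 1 := by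
  refine le_antisymm (fun x hx a b hab => ?_) (fun x hx => ?_)
  · rcases Nat.lt_or_ge a.1 b.1 with h | h
    · exact toMatrix_eq_zero _ h
    obtain rfl : a = b := Subtype.ext (by omega)
    let χ : PathAlgebra k (LinearQuiver m) →+* k :=
      { toFun := fun x => toMatrix x a a
        map_one' := by rw [map_one, Matrix.one_apply_eq]
        map_zero' := by rw [map_zero]; rfl
        map_add' := fun x y => by rw [map_add]; rfl
        map_mul' := fun x y => by
          rw [map_mul, Matrix.mul_apply, Finset.sum_eq_single a]
          · intro c _ hc
            rcases Nat.lt_or_ge a.1 c.1 with h | h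
            · rw [toMatrix_eq_zero x h, zero_mul]
            · have : c.1 ≠ a.1 := fun h => hc (Subtype.ext h)
              rw [toMatrix_eq_zero y (show c.1 < a.1 by omega), mul_zero]
          · simp }
    have hχ : Function.Surjective χ := fun c =>
      ⟨c • 1, by change toMatrix (c • 1) a a = c; rw [toMatrix_smul, map_one]; simp⟩
    have : RingHomSurjective χ := ⟨hχ⟩
    have := Ring.le_comap_jacobson χ hx
    rw [IsSemisimpleRing.jacobson_eq_bot] at this
    exact this
  · rw [← Ideal.jacobson_bot, Ideal.mem_jacobson_iff]
    intro y
    have hyx : y * x ∈ longPaths k m 1 := (longPaths k m 1).mul_mem_left y hx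
    have hnil : IsNilpotent (y * x) := ⟨m, by
      have h := pow_mem_longPaths hyx m
      rwa [longPaths_eq_bot] at h⟩
    obtain ⟨z, hz⟩ := hnil.isUnit_one_add.exists_left_inv
    refine ⟨z, ?_⟩
    rw [Ideal.mem_bot, ← hz]
    noncomm_ring

/-- A path of length at least `n + 1` is a path of length at least `n` followed by an arrow. -/
theorem jacobson_pow_eq (n : ℕ) :
    Ring.jacobson (PathAlgebra k (LinearQuiver m)) ^ n = longPaths k m n := by
  induction n with
  | zero =>
    rw [Submodule.pow_zero, Ideal.one_eq_top, eq_comm, Ideal.eq_top_iff_one]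
    exact fun a b h => toMatrix_eq_zero _ h
  | succ n ih =>
    rw [Submodule.pow_succ, ih, jacobson_eq]
    refine le_antisymm (Ideal.mul_le.2 fun x hx y hy => mul_mem_longPaths hx hy) fun x hx => ?_
    classical
    -- multiplication by the sum `s` of all arrows shifts the columns of a matrix
    obtain ⟨s, hs⟩ := exists_toMatrix_eq (k := k) (m := m)
      (Matrix.of fun a b => if a.1 = b.1 + 1 then 1 else 0)
      (fun a b h => by rw [Matrix.of_apply, if_neg (by omega)])
    have hy0 : ∀ (a c : LinearQuiver m), a.1 < c.1 + n →
        (if h : 2 ≤ c.1 then toMatrix x a ⟨c.1 - 1, Finset.mem_Icc.2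
          (by have := Finset.mem_Icc.1 c.2; omega)⟩ else 0) = 0 := by
      intro a c hac
      split_ifs with h
      · exact hx _ _ (by change a.1 < c.1 - 1 + (n + 1); omega)
      · rfl
    obtain ⟨y, hy⟩ := exists_toMatrix_eq (k := k) (m := m)
      (Matrix.of fun a c => if h : 2 ≤ c.1 then toMatrix x a ⟨c.1 - 1, Finset.mem_Icc.2
          (by have := Finset.mem_Icc.1 c.2; omega)⟩ else 0)
      (fun a c h => hy0 a c (by omega))
    have hxy : x = y * s := by
      refine toMatrix_injective ?_
      rw [map_mul, hy, hs]
      ext a b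
      rw [Matrix.mul_apply]
      simp only [Matrix.of_apply]
      have ha := Finset.mem_Icc.1 a.2
      have hb := Finset.mem_Icc.1 b.2
      rcases Nat.lt_or_ge b.1 m with hbm | hbm
      · let c : LinearQuiver m := ⟨b.1 + 1, Finset.mem_Icc.2 (by omega)⟩
        rw [Finset.sum_eq_single c]
        · have h2 : 2 ≤ c.1 := by change 2 ≤ b.1 + 1; omega
          rw [dif_pos h2, if_pos rfl, mul_one]
          rfl
        · intro c' _ hc'
          rw [if_neg (fun h => hc' (Subtype.ext h)), mul_zero]
        · simp
      · rw [hx a b (by omega), Finset.sum_eq_zero]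
        intro c _
        have hc := Finset.mem_Icc.1 c.2
        rw [if_neg (by omega), mul_zero]
    rw [hxy]
    refine Ideal.mul_mem_mul (fun a c h => by rw [hy]; exact hy0 a c h) fun a b h => ?_
    rw [hs, Matrix.of_apply, if_neg (by omega)]

theorem mem_jacobson_pow {n : ℕ} {x : PathAlgebra k (LinearQuiver m)} :
    x ∈ Ring.jacobson (PathAlgebra k (LinearQuiver m)) ^ n ↔
      ∀ a b : LinearQuiver m, a.1 < b.1 + n → toMatrix x a b = 0 := by
  rw [jacobson_pow_eq]; rfl

end PathAlgebra

namespace NakayamaAlgebra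

variable {k : Type u} [Field k] {m ℓ : ℕ}

/-- The coefficient of the path `a ⟶ b` in an element of `Φ`; it is zero unless there is such a path
of length less than `ℓ`. -/
def coeff (x : NakayamaAlgebra k m ℓ) (a b : LinearQuiver m) : k :=
  if a.1 < b.1 + ℓ then
    PathAlgebra.toMatrix (Function.surjInv Ideal.Quotient.mk_surjective x) a b else 0

theorem coeff_mk (x : PathAlgebra k (LinearQuiver m)) (a b : LinearQuiver m) :
    coeff (Ideal.Quotient.mk _ x : NakayamaAlgebra k m ℓ) a b =
      if a.1 < b.1 + ℓ then PathAlgebra.toMatrix x a b else 0 := by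
  rw [coeff]
  split_ifs with h
  · have h1 := Function.surjInv_eq (Ideal.Quotient.mk_surjective
      (I := Ring.jacobson (PathAlgebra k (LinearQuiver m)) ^ ℓ)) (Ideal.Quotient.mk _ x)
    rw [Ideal.Quotient.eq, PathAlgebra.mem_jacobson_pow] at h1
    have h2 := h1 a b h
    rw [map_sub, Matrix.sub_apply, sub_eq_zero] at h2
    exact h2
  · rfl

theorem coeff_add (x y : NakayamaAlgebra k m ℓ) (a b : LinearQuiver m) :
    coeff (x + y) a b = coeff x a b + coeff y a b := by
  obtain ⟨x, rfl⟩ := Ideal.Quotient.mk_surjective x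
  obtain ⟨y, rfl⟩ := Ideal.Quotient.mk_surjective y
  rw [← map_add, coeff_mk, coeff_mk, coeff_mk, map_add, Matrix.add_apply]
  split_ifs <;> simp

theorem coeff_smul (c : k) (x : NakayamaAlgebra k m ℓ) (a b : LinearQuiver m) :
    coeff (c • x) a b = c * coeff x a b := by
  obtain ⟨x, rfl⟩ := Ideal.Quotient.mk_surjective x
  have : c • (Ideal.Quotient.mk _ x : NakayamaAlgebra k m ℓ) = Ideal.Quotient.mk _ (c • x) := rfl
  rw [this, coeff_mk, coeff_mk, PathAlgebra.toMatrix_smul]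
  split_ifs <;> simp

theorem coeff_eq_zero (x : NakayamaAlgebra k m ℓ) {a b : LinearQuiver m}
    (h : ¬(b.1 ≤ a.1 ∧ a.1 < b.1 + ℓ)) : coeff x a b = 0 := by
  obtain ⟨x, rfl⟩ := Ideal.Quotient.mk_surjective x
  rw [coeff_mk]
  split_ifs with h'
  · exact PathAlgebra.toMatrix_eq_zero _ (by omega)
  · rfl

theorem coeff_mul (x y : NakayamaAlgebra k m ℓ) {a c : LinearQuiver m} (h : a.1 < c.1 + ℓ) :
    coeff (x * y) a c = ∑ b, coeff x a b * coeff y b c := by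
  obtain ⟨x, rfl⟩ := Ideal.Quotient.mk_surjective x
  obtain ⟨y, rfl⟩ := Ideal.Quotient.mk_surjective y
  rw [← map_mul, coeff_mk, if_pos h, map_mul, Matrix.mul_apply]
  refine Finset.sum_congr rfl fun b _ => ?_
  rw [coeff_mk, coeff_mk]
  rcases Nat.lt_or_ge a.1 b.1 with h1 | h1
  · rw [PathAlgebra.toMatrix_eq_zero x h1]; simp
  rcases Nat.lt_or_ge b.1 c.1 with h2 | h2
  · rw [PathAlgebra.toMatrix_eq_zero y h2]; simp
  rw [if_pos (by omega), if_pos (by omega)]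

theorem coeff_ext {x y : NakayamaAlgebra k m ℓ} (h : ∀ a b, coeff x a b = coeff y a b) :
    x = y := by
  obtain ⟨x, rfl⟩ := Ideal.Quotient.mk_surjective x
  obtain ⟨y, rfl⟩ := Ideal.Quotient.mk_surjective y
  rw [Ideal.Quotient.eq, PathAlgebra.mem_jacobson_pow]
  intro a b hab
  have := h a b
  rw [coeff_mk, coeff_mk, if_pos hab, if_pos hab] at this
  rw [map_sub, Matrix.sub_apply, this, sub_self]

theorem exists_coeff_eq (g : LinearQuiver m → LinearQuiver m → k)
    (h : ∀ a b, ¬(b.1 ≤ a.1 ∧ a.1 < b.1 + ℓ) → g a b = 0) :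
    ∃ x : NakayamaAlgebra k m ℓ, ∀ a b, coeff x a b = g a b := by
  obtain ⟨x, hx⟩ := PathAlgebra.exists_toMatrix_eq (Matrix.of g)
    (fun a b hab => h a b (by omega))
  refine ⟨Ideal.Quotient.mk _ x, fun a b => ?_⟩
  rw [coeff_mk, hx]
  split_ifs with hab
  · rfl
  · rw [h a b (by omega)]

theorem coeff_e (hℓ : 0 < ℓ) (v a b : LinearQuiver m) :
    coeff (e k m ℓ v.1) a b = if a = v ∧ b = v then 1 else 0 := by
  have h1 : e k m ℓ v.1 = Ideal.Quotient.mk _ (PathAlgebra.idem k v) := dif_pos v.2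
  rw [h1, coeff_mk, PathAlgebra.toMatrix_idem]
  by_cases h : a = v ∧ b = v
  · rw [if_pos (by rw [h.1, h.2]; omega)]
  · rw [if_neg h, ite_self]

theorem coeff_one (hℓ : 0 < ℓ) (a b : LinearQuiver m) :
    coeff (1 : NakayamaAlgebra k m ℓ) a b = if a = b then 1 else 0 := by
  rw [← map_one (Ideal.Quotient.mk _), coeff_mk, map_one, Matrix.one_apply]
  by_cases h : a = b
  · rw [if_pos (by rw [h]; omega)]
  · rw [if_neg h, ite_self]

end NakayamaAlgebra

end

noncomputable section

/-! ### The modules `f_i` as interval modules -/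

namespace NakayamaAlgebra

variable {k : Type u} [Field k] {m ℓ : ℕ}

/-- Coordinates identifying the right `Φ`-module `X` with the interval module with support
`{a | i - ℓ < a ≤ i}`, on which the elements of `Φ` act through row vector times matrix. -/
structure IntervalCoord (X : RightMod k m ℓ) (i : ℕ) where
  coord : X →+ (LinearQuiver m → k)
  injective : Function.Injective coord
  coord_eq_zero : ∀ x a, ¬(a.1 ≤ i ∧ i < a.1 + ℓ) → coord x a = 0
  exists_coord_eq : ∀ g : LinearQuiver m → k, (∀ a, ¬(a.1 ≤ i ∧ i < a.1 + ℓ) → g a = 0) →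
    ∃ x, ∀ a, coord x a = g a
  coord_smul : ∀ (r : NakayamaAlgebra k m ℓ) x a, a.1 ≤ i → i < a.1 + ℓ →
    coord (MulOpposite.op r • x) a = ∑ b, coord x b * coeff r b a

namespace IntervalCoord

variable {X Y Z : RightMod k m ℓ} {i j t : ℕ}

theorem ext (κ : IntervalCoord X i) {x y : X}
    (h : ∀ a : LinearQuiver m, a.1 ≤ i → i < a.1 + ℓ → κ.coord x a = κ.coord y a) : x = y := by
  refine κ.injective (funext fun a => ?_)
  by_cases ha : a.1 ≤ i ∧ i < a.1 + ℓ
  · exact h a ha.1 ha.2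
  · rw [κ.coord_eq_zero x a ha, κ.coord_eq_zero y a ha]

/-- For `i ≤ j`, the projection of coordinate vectors on the support of `Y` is a homomorphism. -/
theorem exists_hom (κ : IntervalCoord X i) (κ' : IntervalCoord Y j) (hij : i ≤ j) :
    ∃ g : X ⟶ Y, ∀ x (a : LinearQuiver m), a.1 ≤ j → j < a.1 + ℓ →
      κ'.coord (g x) a = κ.coord x a := by
  have : ∀ x : X, ∃ y : Y, ∀ a : LinearQuiver m,
      κ'.coord y a = if a.1 ≤ j ∧ j < a.1 + ℓ then κ.coord x a else 0 :=
    fun x => κ'.exists_coord_eq _ fun a ha => if_neg ha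
  choose g hg using this
  have hg' : ∀ x (a : LinearQuiver m), a.1 ≤ j → j < a.1 + ℓ → κ'.coord (g x) a = κ.coord x a :=
    fun x a h h' => by rw [hg, if_pos ⟨h, h'⟩]
  refine ⟨ModuleCat.ofHom
    { toFun := g
      map_add' := fun x y => κ'.ext fun a h h' => ?_
      map_smul' := fun r x => κ'.ext fun a h h' => ?_ }, hg'⟩
  · rw [hg' _ a h h', map_add, map_add, Pi.add_apply, Pi.add_apply, hg' _ a h h', hg' _ a h h']
  · rw [hg' _ a h h']
    change κ.coord (MulOpposite.op r.unop • x) a = κ'.coord (MulOpposite.op r.unop • g x) a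
    rw [κ'.coord_smul _ _ a h h']
    by_cases ha : a.1 ≤ i
    · rw [κ.coord_smul _ _ a ha (by omega)]
      refine Finset.sum_congr rfl fun b _ => ?_
      rw [hg]
      split_ifs with hb
      · rfl
      by_cases hab : a.1 ≤ b.1
      · rw [κ.coord_eq_zero x b (by omega), zero_mul]
      · rw [coeff_eq_zero _ (by omega), mul_zero, mul_zero]
    · rw [κ.coord_eq_zero _ a (by omega), Finset.sum_eq_zero]
      intro b _
      rw [hg]
      split_ifs with hb
      · by_cases hbi : b.1 ≤ i
        · rw [coeff_eq_zero _ (by omega), mul_zero]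
        · rw [κ.coord_eq_zero x b (by omega), zero_mul]
      · rw [zero_mul]

/-- The canonical homomorphism between interval modules. -/
def hom (κ : IntervalCoord X i) (κ' : IntervalCoord Y j) (hij : i ≤ j) : X ⟶ Y :=
  (κ.exists_hom κ' hij).choose

theorem coord_hom (κ : IntervalCoord X i) (κ' : IntervalCoord Y j) (hij : i ≤ j) (x : X)
    (a : LinearQuiver m) (h : a.1 ≤ j) (h' : j < a.1 + ℓ) :
    κ'.coord (κ.hom κ' hij x) a = κ.coord x a :=
  (κ.exists_hom κ' hij).choose_spec x a h h'

theorem hom_refl (κ : IntervalCoord X i) : κ.hom κ le_rfl = 𝟙 X := by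
  ext x
  exact κ.ext fun a h h' => κ.coord_hom κ le_rfl x a h h'

theorem hom_comp (κ : IntervalCoord X i) (κ' : IntervalCoord Y j) (κ'' : IntervalCoord Z t)
    (hij : i ≤ j) (hjt : j ≤ t) :
    κ.hom κ' hij ≫ κ'.hom κ'' hjt = κ.hom κ'' (hij.trans hjt) := by
  ext x
  refine κ''.ext fun a h h' => ?_
  rw [κ.coord_hom κ'' _ x a h h']
  change κ''.coord (κ'.hom κ'' hjt (κ.hom κ' hij x)) a = _
  rw [κ'.coord_hom κ'' _ _ a h h']
  by_cases ha : a.1 ≤ j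
  · exact κ.coord_hom κ' hij x a ha (by omega)
  · rw [κ'.coord_eq_zero _ _ (by omega), κ.coord_eq_zero _ _ (by omega)]

/-- The canonical homomorphism vanishes exactly if the supports are disjoint. -/
theorem hom_eq_zero_iff (κ : IntervalCoord X i) (κ' : IntervalCoord Y j) (hij : i ≤ j)
    (hi : 1 ≤ i) (hm : 1 ≤ m) (hj : j + 1 ≤ m + ℓ) : κ.hom κ' hij = 0 ↔ i + ℓ ≤ j := by
  constructor
  · intro h0
    by_contra! hlt
    let a : LinearQuiver m := ⟨min i m, Finset.mem_Icc.2 (by omega)⟩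
    have ha : a.1 = min i m := rfl
    obtain ⟨x, hx⟩ := κ.exists_coord_eq (fun b => if b = a then 1 else 0)
      (fun b hb => if_neg (by rintro rfl; omega))
    have h1 := κ.coord_hom κ' hij x a (by omega) (by omega)
    rw [h0, hx, if_pos rfl] at h1
    change κ'.coord 0 a = 1 at h1
    rw [map_zero] at h1
    exact zero_ne_one h1
  · intro h
    ext x
    refine κ'.ext fun a ha ha' => ?_
    rw [κ.coord_hom κ' hij x a ha ha', κ.coord_eq_zero x a (by omega)]
    change _ = κ'.coord 0 a
    rw [map_zero]; rfl

/-- A homomorphism from an interval module is determined by the image of the basis vector at the top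
of its support. -/
theorem exists_coord_eq_mul (κ : IntervalCoord X i) (κ' : IntervalCoord Y j) (hℓ : 0 < ℓ)
    (hi : 1 ≤ i) (hm : 1 ≤ m) (hiN : i + 1 ≤ m + ℓ) (g : X ⟶ Y) :
    ∃ c : k, (∀ x (a : LinearQuiver m), a.1 ≤ j → j < a.1 + ℓ →
      κ'.coord (g x) a = c * κ.coord x a) ∧ (¬(min i m ≤ j ∧ j < min i m + ℓ) → c = 0) := by
  let t : LinearQuiver m := ⟨min i m, Finset.mem_Icc.2 (by omega)⟩
  have ht : t.1 = min i m := rfl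
  obtain ⟨v, hv⟩ := κ.exists_coord_eq (fun b => if b = t then 1 else 0)
    (fun b hb => if_neg (by rintro rfl; omega))
  refine ⟨κ'.coord (g v) t, fun x a h h' => ?_, fun h => κ'.coord_eq_zero _ _ h⟩
  obtain ⟨r, hr⟩ := exists_coeff_eq (ℓ := ℓ) (fun b c => if b = t then κ.coord x c else 0) (by
    intro b c hbc
    split_ifs with hb
    · subst hb
      have hc := Finset.mem_Icc.1 c.2
      exact κ.coord_eq_zero x c (by omega)
    · rfl)
  have hx : x = MulOpposite.op r • v := by
    refine κ.ext fun c hc hc' => ?_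
    rw [κ.coord_smul r v c hc hc', Finset.sum_eq_single t]
    · rw [hv, if_pos rfl, hr, if_pos rfl, one_mul]
    · intro b _ hb
      rw [hv, if_neg hb, zero_mul]
    · simp
  have hgx : g x = MulOpposite.op r • g v := by rw [hx]; exact map_smul g.hom _ _
  rw [hgx, κ'.coord_smul r _ a h h', Finset.sum_eq_single t]
  · rw [hr, if_pos rfl]
  · intro b _ hb
    rw [hr, if_neg hb, mul_zero]
  · simp

/-- There are no nonzero homomorphisms to interval modules of smaller index. Here `ℓ < m` is used:
for `m ≤ j < i ≤ ℓ` both supports would consist of all vertices. -/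
theorem eq_zero_of_lt (κ : IntervalCoord X i) (κ' : IntervalCoord Y j) (hℓ : 0 < ℓ)
    (hi : 1 ≤ i) (hm : ℓ < m) (hiN : i + 1 ≤ m + ℓ) (hji : j < i) (g : X ⟶ Y) : g = 0 := by
  obtain ⟨c, hc, hc'⟩ := κ.exists_coord_eq_mul κ' hℓ hi (by omega) hiN g
  suffices h : c = 0 by
    ext x
    refine κ'.ext fun a ha ha' => ?_
    rw [hc x a ha ha', h, zero_mul]
    change _ = κ'.coord 0 a
    rw [map_zero]; rfl
  by_cases ht : min i m ≤ j ∧ j < min i m + ℓ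
  swap
  · exact hc' ht
  -- now `m ≤ j < i`, so the vertex `i - ℓ` is in the support of `Y` but not in that of `X`; the top
  -- basis vector `v` of `X` is annihilated by the path `m ⟶ i - ℓ`, unlike its multiple in `Y`
  let t : LinearQuiver m := ⟨m, Finset.mem_Icc.2 (by omega)⟩
  let s : LinearQuiver m := ⟨i - ℓ, Finset.mem_Icc.2 (by omega)⟩
  have hts : t.1 = m ∧ s.1 = i - ℓ := ⟨rfl, rfl⟩
  obtain ⟨v, hv⟩ := κ.exists_coord_eq (fun b => if b = t then 1 else 0)
    (fun b hb => if_neg (by rintro rfl; omega))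
  obtain ⟨r, hr⟩ := exists_coeff_eq (k := k) (ℓ := ℓ)
    (fun b c => if b = t ∧ c = s then 1 else 0)
    (fun b c hbc => if_neg (by rintro ⟨rfl, rfl⟩; omega))
  have hrv : MulOpposite.op r • v = 0 := by
    refine κ.ext fun a ha ha' => ?_
    rw [κ.coord_smul r v a ha ha', map_zero, Pi.zero_apply]
    refine Finset.sum_eq_zero fun b _ => ?_
    rw [hr, if_neg (by rintro ⟨-, rfl⟩; omega), mul_zero]
  have h1 : MulOpposite.op r • g v = 0 := by
    have := map_smul g.hom (MulOpposite.op r) v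
    rw [hrv, map_zero] at this
    exact this.symm
  have h2 := κ'.coord_smul r (g v) s (by omega) (by omega)
  rw [h1, map_zero, Pi.zero_apply, Finset.sum_eq_single t] at h2
  · rw [hr, if_pos ⟨rfl, rfl⟩, mul_one, hc v t (by omega) (by omega), hv, if_pos rfl,
      mul_one] at h2
    exact h2.symm
  · intro b _ hb
    rw [hr, if_neg (fun h => hb h.1), mul_zero]
  · simp

theorem coord_op_algebraMap_smul (κ : IntervalCoord X i) (hℓ : 0 < ℓ) (c : k) (x : X)
    (a : LinearQuiver m) :
    κ.coord (algebraMap k (NakayamaAlgebra k m ℓ)ᵐᵒᵖ c • x) a = c * κ.coord x a := by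
  have h0 : algebraMap k (NakayamaAlgebra k m ℓ)ᵐᵒᵖ c =
      MulOpposite.op (c • (1 : NakayamaAlgebra k m ℓ)) := by
    rw [← Algebra.algebraMap_eq_smul_one]; rfl
  by_cases ha : a.1 ≤ i ∧ i < a.1 + ℓ
  · rw [h0, κ.coord_smul _ _ a ha.1 ha.2, Finset.sum_eq_single a]
    · rw [coeff_smul, coeff_one hℓ, if_pos rfl, mul_one, mul_comm]
    · intro b _ hb
      rw [coeff_smul, coeff_one hℓ, if_neg hb, mul_zero, mul_zero]
    · simp
  · rw [κ.coord_eq_zero _ a ha, κ.coord_eq_zero _ a ha, mul_zero]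

theorem exists_eq_smul_hom (κ : IntervalCoord X i) (κ' : IntervalCoord Y j) (hℓ : 0 < ℓ)
    (hi : 1 ≤ i) (hm : 1 ≤ m) (hiN : i + 1 ≤ m + ℓ) (hij : i ≤ j) (g : X ⟶ Y) :
    ∃ c : k, g = c • κ.hom κ' hij := by
  obtain ⟨c, hc, -⟩ := κ.exists_coord_eq_mul κ' hℓ hi hm hiN g
  refine ⟨c, ?_⟩
  ext x
  refine κ'.ext fun a ha ha' => ?_
  rw [hc x a ha ha', ← κ.coord_hom κ' hij x a ha ha', ← κ'.coord_op_algebraMap_smul hℓ]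
  rfl

end IntervalCoord

/-- The projective module `e_i Φ` is the interval module with support `{a | i - ℓ < a ≤ i}`. -/
theorem nonempty_intervalCoord_projMod (hℓ : 0 < ℓ) (i : LinearQuiver m) :
    Nonempty (IntervalCoord (projMod k m ℓ i.1) i.1) := by
  have hmem : ∀ x : projMod k m ℓ i.1, ∀ b a, b ≠ i → coeff x.1 b a = 0 := by
    intro x b a hb
    obtain ⟨r, hr⟩ := Submodule.mem_span_singleton.1 x.2
    rw [← hr]
    change coeff (e k m ℓ i.1 * r.unop) b a = 0
    by_cases hba : b.1 < a.1 + ℓ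
    · rw [coeff_mul _ _ hba]
      refine Finset.sum_eq_zero fun c _ => ?_
      rw [coeff_e hℓ, if_neg (fun h => hb h.1), zero_mul]
    · exact coeff_eq_zero _ (by omega)
  exact ⟨{
    coord :=
      { toFun := fun x a => coeff x.1 i a
        map_zero' := funext fun a => by
          have := coeff_add (0 : NakayamaAlgebra k m ℓ) 0 i a
          rw [add_zero, left_eq_add] at this
          exact this
        map_add' := fun x y => funext fun a => coeff_add x.1 y.1 i a }
    injective := fun x y h => Subtype.ext (coeff_ext fun b a => by
      by_cases hb : b = i
      · rw [hb]; exact congrFun h a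
      · rw [hmem x b a hb, hmem y b a hb])
    coord_eq_zero := fun x a ha => coeff_eq_zero _ ha
    exists_coord_eq := fun g hg => by
      obtain ⟨r, hr⟩ := exists_coeff_eq (ℓ := ℓ) (fun b a => if b = i then g a else 0) (by
        intro b a hba
        split_ifs with hb
        · subst hb; exact hg a hba
        · rfl)
      have hre : e k m ℓ i.1 * r = r := by
        refine coeff_ext fun b a => ?_
        by_cases hba : b.1 < a.1 + ℓ
        · rw [coeff_mul _ _ hba, Finset.sum_eq_single i]
          · rw [coeff_e hℓ, hr, hr, if_pos rfl]
            by_cases hb : b = i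
            · rw [if_pos ⟨hb, rfl⟩, if_pos hb, one_mul]
            · rw [if_neg (fun h => hb h.1), if_neg hb, zero_mul]
          · intro c _ hc
            rw [coeff_e hℓ, if_neg (fun h => hc h.2), zero_mul]
          · simp
        · rw [coeff_eq_zero _ (by omega), coeff_eq_zero _ (by omega)]
      exact ⟨⟨r, Submodule.mem_span_singleton.2 ⟨MulOpposite.op r, hre⟩⟩, fun a => by
        change coeff r i a = g a
        rw [hr, if_pos rfl]⟩
    coord_smul := fun r x a h h' => coeff_mul x.1 r h' }⟩

/-- The injective module `D(Φ e_s)` is the interval module with support `{a | s ≤ a}` if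
`m < s + ℓ`. -/
theorem nonempty_intervalCoord_injMod (hℓ : 0 < ℓ) (s : LinearQuiver m) {i : ℕ}
    (hi : i + 1 = s.1 + ℓ) (hm : m ≤ i) :
    Nonempty (IntervalCoord (injMod k m ℓ s.1) i) := by
  have hle : ∀ a : LinearQuiver m, a.1 ≤ i := fun a => (Finset.mem_Icc.1 a.2).2.trans hm
  let P := Submodule.span (NakayamaAlgebra k m ℓ) {e k m ℓ s.1}
  have hmem : ∀ x : P, ∀ a b, b ≠ s → coeff x.1 a b = 0 := by
    intro x a b hb
    obtain ⟨r, hr⟩ := Submodule.mem_span_singleton.1 x.2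
    rw [← hr, smul_eq_mul]
    by_cases hba : a.1 < b.1 + ℓ
    · rw [coeff_mul _ _ hba]
      refine Finset.sum_eq_zero fun c _ => ?_
      rw [coeff_e hℓ, if_neg (fun h => hb h.2), mul_zero]
    · exact coeff_eq_zero _ (by omega)
  -- the basis of `Φ e_s` consisting of the paths `a ⟶ s`
  have hE : ∀ a : LinearQuiver m, ∃ x : P, ∀ b c,
      coeff x.1 b c = if (b = a ∧ c = s) ∧ s.1 ≤ a.1 then 1 else 0 := by
    intro a
    obtain ⟨r, hr⟩ := exists_coeff_eq (k := k) (ℓ := ℓ)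
      (fun b c => if (b = a ∧ c = s) ∧ s.1 ≤ a.1 then 1 else 0)
      (fun b c hbc => if_neg (by
        rintro ⟨⟨rfl, rfl⟩, h⟩
        have := hle b
        omega))
    refine ⟨⟨r, Submodule.mem_span_singleton.2 ⟨r, coeff_ext fun b c => ?_⟩⟩, hr⟩
    rw [smul_eq_mul]
    by_cases hbc : b.1 < c.1 + ℓ
    · rw [coeff_mul _ _ hbc, Finset.sum_eq_single s]
      · rw [coeff_e hℓ, hr, hr]
        by_cases hc : c = s
        · simp [hc]
        · simp [hc]
      · intro c' _ hc'
        rw [coeff_e hℓ, if_neg (fun h => hc' h.1), mul_zero]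
      · simp
    · rw [coeff_eq_zero _ (by omega), coeff_eq_zero _ (by omega)]
  choose E hE using hE
  have hcoeffE : ∀ a b c : LinearQuiver m, s.1 ≤ a.1 →
      coeff (E a).1 b c = if b = a ∧ c = s then 1 else 0 := by
    intro a b c ha
    rw [hE]
    simp [ha]
  have hEzero : ∀ a : LinearQuiver m, ¬ s.1 ≤ a.1 → E a = 0 := by
    intro a ha
    refine Subtype.ext (coeff_ext fun b c => ?_)
    rw [hE, if_neg (fun h => ha h.2)]
    have := coeff_add (0 : NakayamaAlgebra k m ℓ) 0 b c
    rw [add_zero, left_eq_add] at this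
    exact this.symm
  let co : LinearQuiver m → LinearQuiver m → NakayamaAlgebra k m ℓ →ₗ[k] k := fun a b =>
    { toFun := fun x => coeff x a b
      map_add' := fun x y => coeff_add x y a b
      map_smul' := fun c x => coeff_smul c x a b }
  have hsum : ∀ x : P, x = ∑ a, coeff x.1 a s • E a := by
    intro x
    refine Subtype.ext (coeff_ext fun b c => ?_)
    have h1 : coeff (∑ a, coeff x.1 a s • E a : P).1 b c =
        ∑ a, coeff x.1 a s * coeff (E a).1 b c := by
      change co b c ((∑ a, coeff x.1 a s • E a : P) : NakayamaAlgebra k m ℓ) = _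
      rw [Submodule.coe_sum, map_sum]
      refine Finset.sum_congr rfl fun a _ => ?_
      exact coeff_smul _ _ _ _
    rw [h1, Finset.sum_eq_single b]
    · rw [hE]
      by_cases hc : c = s
      · subst hc
        by_cases hb : c.1 ≤ b.1
        · simp [hb]
        · rw [coeff_eq_zero x.1 (by omega), zero_mul]
      · rw [hmem x b c hc, if_neg (fun h => hc h.1.2), mul_zero]
    · intro a _ hab
      rw [hE, if_neg (fun h => hab h.1.1.symm), mul_zero]
    · simp
  let F : DualModule k (NakayamaAlgebra k m ℓ) P → P →ₗ[k] k := DualModule.toForm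
  exact ⟨{
    coord :=
      { toFun := fun f a => F f (E a)
        map_zero' := rfl
        map_add' := fun _ _ => rfl }
    injective := fun f g h => LinearMap.ext fun x => by
      change F f x = F g x
      rw [hsum x, map_sum, map_sum]
      refine Finset.sum_congr rfl fun a _ => ?_
      rw [map_smul, map_smul]
      exact congrArg _ (congrFun h a)
    coord_eq_zero := fun f a ha => by
      have := hle a
      change F f (E a) = 0
      rw [hEzero a (by omega), map_zero]
    exists_coord_eq := fun g hg => by
      let f : P →ₗ[k] k := ∑ b, g b • (co b s ∘ₗ P.subtype.restrictScalars k)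
      refine ⟨f, fun a => ?_⟩
      change f (E a) = g a
      have h1 : f (E a) = ∑ b, g b * coeff (E a).1 b s := by
        simp only [f, LinearMap.sum_apply, LinearMap.smul_apply]
        rfl
      by_cases ha : s.1 ≤ a.1
      · rw [h1, Finset.sum_eq_single a]
        · rw [hcoeffE a a s ha]; simp
        · intro b _ hb
          rw [hcoeffE a b s ha, if_neg (fun h => hb h.1), mul_zero]
        · simp
      · rw [hEzero a ha, map_zero, hg a (by omega)]
    coord_smul := fun r f a h h' => by
      change F f (r • E a) = ∑ b, F f (E b) * coeff r b a
      rw [hsum (r • E a), map_sum]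
      refine Finset.sum_congr rfl fun b _ => ?_
      rw [map_smul, smul_eq_mul, mul_comm]
      congr 1
      change coeff (r * (E a).1) b s = _
      have hb := hle b
      rw [coeff_mul _ _ (by omega), Finset.sum_eq_single a]
      · rw [hcoeffE a a s (by omega), if_pos ⟨rfl, rfl⟩, mul_one]
      · intro c _ hc
        rw [hcoeffE a c s (by omega), if_neg (fun h => hc h.1), mul_zero]
      · simp }⟩

theorem nonempty_intervalCoord_fMod (hℓ : 0 < ℓ) (hm : ℓ < m) (i : Idx m ℓ) :
    Nonempty (IntervalCoord (fMod k m ℓ i) i.1) := by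
  have hi := Finset.mem_Icc.1 i.2
  rw [fMod]
  split_ifs with h
  · exact nonempty_intervalCoord_projMod hℓ ⟨i.1, Finset.mem_Icc.2 ⟨hi.1, h⟩⟩
  · exact nonempty_intervalCoord_injMod hℓ ⟨i.1 + 1 - ℓ, Finset.mem_Icc.2 (by omega)⟩
      (by change i.1 + 1 = i.1 + 1 - ℓ + ℓ; omega) (by omega)

end NakayamaAlgebra

end

noncomputable section

/-! ### The category `add (g)` -/

section AddClosure

variable {R : Type u} [Ring R] {g : ModuleCat.{v} R}

theorem addClosure.of_retract {X Y : ModuleCat.{v} R} (r : Retract X Y) (hY : addClosure g Y) :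
    addClosure g X := by
  obtain ⟨n, ⟨s⟩⟩ := hY
  exact ⟨n, ⟨r.trans s⟩⟩

theorem addClosure.prod {X Y : ModuleCat.{v} R} (hX : addClosure g X) (hY : addClosure g Y) :
    addClosure g (ModuleCat.of R (X × Y)) := by
  obtain ⟨n, ⟨r⟩⟩ := hX
  obtain ⟨n', ⟨r'⟩⟩ := hY
  let f : X × Y →ₗ[R] (Fin (n + n') → g) := LinearMap.pi fun a => Fin.addCases
    (motive := fun _ => X × Y →ₗ[R] g)
    (fun b => LinearMap.proj b ∘ₗ r.i.hom ∘ₗ LinearMap.fst R X Y)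
    (fun b => LinearMap.proj b ∘ₗ r'.i.hom ∘ₗ LinearMap.snd R X Y) a
  have hl : ∀ p b, f p (Fin.castAdd n' b) = r.i.hom p.1 b := fun p b => by simp [f]
  have hr : ∀ p b, f p (Fin.natAdd n b) = r'.i.hom p.2 b := fun p b => by simp [f]
  refine ⟨n + n', ⟨{
    i := ModuleCat.ofHom f
    r := ModuleCat.ofHom (LinearMap.prod
      (r.r.hom ∘ₗ LinearMap.funLeft R g (Fin.castAdd n'))
      (r'.r.hom ∘ₗ LinearMap.funLeft R g (Fin.natAdd n)))
    retract := ?_ }⟩⟩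
  refine ModuleCat.hom_ext (LinearMap.ext fun p => Prod.ext ?_ ?_)
  · exact (congrArg r.r.hom (funext (hl p))).trans
      (LinearMap.congr_fun (congrArg ModuleCat.Hom.hom r.retract) p.1)
  · exact (congrArg r'.r.hom (funext (hr p))).trans
      (LinearMap.congr_fun (congrArg ModuleCat.Hom.hom r'.retract) p.2)

instance : IsIdempotentComplete (addClosure g).FullSubcategory where
  idempotents_split X p hp := by
    have hp' : p.hom ≫ p.hom = p.hom := congrArg (fun t => t.hom) hp
    obtain ⟨Y, i, e, hie, hei⟩ := IsIdempotentComplete.idempotents_split X.obj p.hom hp'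
    exact ⟨⟨Y, addClosure.of_retract ⟨i, e, hie⟩ X.property⟩, ObjectProperty.homMk i,
      ObjectProperty.homMk e, ObjectProperty.hom_ext _ hie, ObjectProperty.hom_ext _ hei⟩

instance : Limits.HasZeroObject (addClosure g).FullSubcategory where
  zero := by
    let Z : (addClosure g).FullSubcategory := ⟨ModuleCat.of R (Fin 0 → g), 0, ⟨Retract.refl _⟩⟩
    have : Limits.IsZero Z.obj := ModuleCat.isZero_of_subsingleton _
    exact ⟨Z, (Limits.IsZero.iff_id_eq_zero _).2
      (ObjectProperty.hom_ext _ (this.eq_of_src _ _))⟩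

instance : Limits.HasBinaryBiproducts (addClosure g).FullSubcategory where
  has_binary_biproduct X Y := by
    let b : Limits.BinaryBicone X Y :=
      { pt := ⟨ModuleCat.of R (X.obj × Y.obj), addClosure.prod X.property Y.property⟩
        fst := ObjectProperty.homMk (ModuleCat.ofHom (LinearMap.fst R X.obj Y.obj))
        snd := ObjectProperty.homMk (ModuleCat.ofHom (LinearMap.snd R X.obj Y.obj))
        inl := ObjectProperty.homMk (ModuleCat.ofHom (LinearMap.inl R X.obj Y.obj))
        inr := ObjectProperty.homMk (ModuleCat.ofHom (LinearMap.inr R X.obj Y.obj))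
        inl_fst := rfl
        inl_snd := rfl
        inr_fst := rfl
        inr_snd := rfl }
    refine Limits.hasBinaryBiproduct_of_total b (ObjectProperty.hom_ext _ ?_)
    exact ModuleCat.hom_ext (LinearMap.ext fun p => Prod.ext (add_zero p.1) (zero_add p.2))

end AddClosure

/-! ### The objects `f_i` generate `𝓕` as a chain -/

namespace NakayamaAlgebra

variable {k : Type u} [Field k] {m ℓ : ℕ}

theorem exists_sum_fObj (X : FCat k m ℓ) :
    ∃ (ι : Type) (_ : Fintype ι) (t : ι → Idx m ℓ)
      (ρ : ∀ a, X ⟶ fObj k m ℓ (t a)) (σ : ∀ a, fObj k m ℓ (t a) ⟶ X),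
      ∑ a, ρ a ≫ σ a = 𝟙 X := by
  obtain ⟨n, ⟨r⟩⟩ := X.property
  let S := (NakayamaAlgebra k m ℓ)ᵐᵒᵖ
  let pr : ∀ a : Fin n × Idx m ℓ, (Fin n → fSum k m ℓ) →ₗ[S] fMod k m ℓ a.2 := fun a =>
    (LinearMap.proj (R := S) (φ := fun j => fMod k m ℓ j) a.2) ∘ₗ
      LinearMap.proj (R := S) (φ := fun _ : Fin n => fSum k m ℓ) a.1
  let inc : ∀ a : Fin n × Idx m ℓ, fMod k m ℓ a.2 →ₗ[S] (Fin n → fSum k m ℓ) := fun a =>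
    (LinearMap.single S (fun _ : Fin n => fSum k m ℓ) a.1) ∘ₗ
      (LinearMap.single S (fun j => fMod k m ℓ j) a.2)
  have hsum : ∑ a, inc a ∘ₗ pr a = LinearMap.id := by
    rw [Fintype.sum_prod_type]
    refine LinearMap.ext fun y => ?_
    rw [LinearMap.sum_apply]
    have h1 : ∀ c : Fin n, (∑ i, inc (c, i) ∘ₗ pr (c, i)) y =
        LinearMap.single S (fun _ : Fin n => fSum k m ℓ) c (y c) := by
      intro c
      rw [LinearMap.sum_apply]
      refine (map_sum (LinearMap.single S (fun _ : Fin n => fSum k m ℓ) c)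
        (fun i => LinearMap.single S (fun j => fMod k m ℓ j) i (y c i)) _).symm.trans ?_
      exact congrArg _ (Finset.univ_sum_single (M := fun j => fMod k m ℓ j) (y c))
    simp only [h1]
    exact Finset.univ_sum_single y
  refine ⟨Fin n × Idx m ℓ, inferInstance, fun a => a.2,
    fun a => ObjectProperty.homMk (r.i ≫ ModuleCat.ofHom (pr a)),
    fun a => ObjectProperty.homMk (ModuleCat.ofHom (inc a) ≫ r.r), ?_⟩
  refine (addClosure (fSum k m ℓ)).ι.map_injective ?_
  rw [Functor.map_sum]
  have h2 : ∀ a, (addClosure (fSum k m ℓ)).ι.map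
      (ObjectProperty.homMk (r.i ≫ ModuleCat.ofHom (pr a)) ≫
        ObjectProperty.homMk (X := fObj k m ℓ a.2) (Y := X) (ModuleCat.ofHom (inc a) ≫ r.r)) =
      r.i ≫ ModuleCat.ofHom (inc a ∘ₗ pr a) ≫ r.r := fun a => rfl
  refine (Finset.sum_congr rfl fun a _ => h2 a).trans ?_
  rw [← Preadditive.comp_sum, ← Preadditive.sum_comp]
  have h3 : ∑ a, ModuleCat.ofHom (inc a ∘ₗ pr a) =
      𝟙 (ModuleCat.of S (Fin n → fSum k m ℓ)) := by
    refine ModuleCat.hom_ext ?_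
    rw [ModuleCat.hom_sum]
    exact hsum
  rw [h3, Category.id_comp]
  exact r.retract

/-- The objects `f_i` with the canonical homomorphisms between interval modules. -/
def family (hℓ : 0 < ℓ) (hm : ℓ < m) :
    NakayamaFamily k (m + ℓ - 1) ℓ (fObj k m ℓ) where
  b {i j} h := ObjectProperty.homMk
    ((nonempty_intervalCoord_fMod hℓ hm i).some.hom (nonempty_intervalCoord_fMod hℓ hm j).some h)
  b_refl i := ObjectProperty.hom_ext _ (IntervalCoord.hom_refl _)
  b_comp h h' := ObjectProperty.hom_ext _ (IntervalCoord.hom_comp _ _ _ h h')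
  b_eq_zero_iff {i j} h := by
    have hi := Finset.mem_Icc.1 i.2
    have hj := Finset.mem_Icc.1 j.2
    rw [← IntervalCoord.hom_eq_zero_iff (nonempty_intervalCoord_fMod (k := k) hℓ hm i).some
      (nonempty_intervalCoord_fMod hℓ hm j).some h hi.1 (by omega) (by omega)]
    exact ⟨fun h0 => congrArg (fun t => t.hom) h0, fun h0 => ObjectProperty.hom_ext _ h0⟩
  hom_eq_smul {i j} h g := by
    have hi := Finset.mem_Icc.1 i.2
    obtain ⟨c, hc⟩ := IntervalCoord.exists_eq_smul_hom
      (nonempty_intervalCoord_fMod (k := k) hℓ hm i).some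
      (nonempty_intervalCoord_fMod hℓ hm j).some hℓ hi.1 (by omega) (by omega) h g.hom
    exact ⟨c, ObjectProperty.hom_ext _ hc⟩
  hom_eq_zero {i j} h g := by
    have hi := Finset.mem_Icc.1 i.2
    exact ObjectProperty.hom_ext _ (IntervalCoord.eq_zero_of_lt
      (nonempty_intervalCoord_fMod (k := k) hℓ hm i).some
      (nonempty_intervalCoord_fMod hℓ hm j).some hℓ hi.1 hm (by omega) h g.hom)
  exists_sum := exists_sum_fObj

end NakayamaAlgebra

end

theorem mainTheorem4 (k : Type u) [Field k] [IsAlgClosed k] (m d ℓ : ℕ)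
    (hm : 3 ≤ m) (hd : 0 < d) (hℓ : 0 < ℓ) (hd_even : Even d)
    (hmd : ((m : ℚ) - 1) / (ℓ : ℚ) = (d : ℚ) / 2)
    (W : ObjectProperty (FCat k m ℓ)) (hW : IsAdditiveSubcategory W) :
    (IsSemisimpleCategory W.FullSubcategory ∧ IsWide d W) ↔
      ∀ i j : Idx m ℓ, i ≠ j → W (fObj k m ℓ i) → W (fObj k m ℓ j) →
        (ℓ : ℤ) ≤ |(i.1 : ℤ) - (j.1 : ℤ)| ∧ |(i.1 : ℤ) - (j.1 : ℤ)| ≤ (m : ℤ) - 1 := by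
  obtain ⟨D, rfl⟩ : ∃ D, d = 2 * D := ⟨d / 2, by obtain ⟨r, rfl⟩ := hd_even; omega⟩
  have hmD : m = D * ℓ + 1 := by
    have hℓ' : (ℓ : ℚ) ≠ 0 := by positivity
    rw [div_eq_iff hℓ'] at hmd
    push_cast at hmd
    have : (m : ℚ) = D * ℓ + 1 := by linarith
    exact_mod_cast this
  have hD : 0 < D := by omega
  have hℓm : ℓ < m := by
    have := Nat.le_mul_of_pos_left ℓ hD
    omega
  rw [(NakayamaAlgebra.family (k := k) hℓ hℓm).semisimple_and_isWide_iff hℓ hD (by omega) hW]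
  constructor
  · intro h i j hij hi hj
    rcases lt_or_gt_of_ne hij with hlt | hgt
    · have := h i j hlt hi hj
      rw [abs_sub_comm, abs_of_nonneg (by omega)]
      omega
    · have := h j i hgt hj hi
      rw [abs_of_nonneg (by omega)]
      omega
  · intro h i j hij hi hj
    have h1 := h i j hij.ne hi hj
    have h2 : i.1 < j.1 := Subtype.coe_lt_coe.2 hij
    rw [abs_sub_comm, abs_of_nonneg (by omega)] at h1
    omega
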